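/- Let $n\ge 2$ and let $E$ be the edge set of the complete graph $K_n$ on $\{1,\dots,n\}$. Let ${\rm CM}_n^2\subseteq\mathbb{C}^E$ be the Cayley–Menger variety, i.e. the Zariski closure of the set of vectors $\big(\|x^{(i)}-x^{(j)}\|_2^2\big)_{ij\in E}$ with $x^{(1)},\dots,x^{(n)}\in\mathbb{R}^2$. Let $\mathcal{M}({\rm CM}_n^2)$ be its algebraic matroid: the matroid on $E$ in which $I\subseteq E$ is independent iff the coordinate projection of ${\rm CM}_n^2$ to $\mathbb{C}^I$ has dimension $|I|$. For a submodular and monotone function $f:2^E\to\mathbb{Z}$, let $\mathcal{M}(f)$ be the matroid on $E$ in which $I$ is independent iff $I=\emptyset$ or $|I'|\le f(I')$ for all nonempty $I'\subseteq I$. Let $G$ be a graph on vertex set $\{1,\dots,n\}$. Then $E(G)$ is independent in $\mathcal{M}({\rm CM}_n^2)$ if and only if for every $m\ge 2$ and every subgraph $H$ of $G$ with $m$ vertices, \[ |E(H)|\le 2m-3 . \] If $E(G)$ is independent in $\mathcal{M}({\rm CM}_n^2)$, then it is a basis if and only if $|E(G)|=2n-3$. Moreover, $\mathcal{M}({\rm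 CM}_n^2)=\mathcal{M}(2r-1)$, where $r$ is the rank function of the graphic matroid of $K_n$. -/

import Mathlib

open MvPolynomial

namespace Rigidity

/-! ### Zariski closure, dimension and the algebraic matroid -/

/-- The smallest variety in `ℂ^E` containing `X`. -/
def zariskiClosure {E : Type*} (X : Set (E → ℂ)) : Set (E → ℂ) :=
  zeroLocus ℂ (vanishingIdeal ℂ X)

/-- The dimension of (the Zariski closure of) a subset of `ℂ^E`: the Krull dimension of its
coordinate ring, the polynomial ring modulo the ideal of polynomials vanishing on the set. -/
noncomputable def zariskiDim {E : Type*} (X : Set (E → ℂ)) : WithBot ℕ∞ :=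
  ringKrullDim (MvPolynomial E ℂ ⧸ vanishingIdeal ℂ X)

/-- The image of `V` under the coordinate projection `ℂ^E → ℂ^I`. -/
def coordProj {E : Type*} (I : Set E) (V : Set (E → ℂ)) : Set (I → ℂ) :=
  (fun (x : E → ℂ) (i : I) ↦ x i) '' V

theorem zariskiDim_eq_card_iff {F : Type*} [Finite F] (X : Set (F → ℂ)) :
    zariskiDim X = (Nat.card F : WithBot ℕ∞) ↔ vanishingIdeal ℂ X = ⊥ := by
  have h0 : ringKrullDim (MvPolynomial F ℂ) = (Nat.card F : WithBot ℕ∞) := by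
    rw [MvPolynomial.ringKrullDim_of_isNoetherianRing, ringKrullDim_eq_zero_of_field, zero_add]
  constructor
  · intro h
    by_contra hne
    obtain ⟨p, hp, hp0⟩ := Submodule.exists_mem_ne_zero_of_ne_bot hne
    have h1 := ringKrullDim_succ_le_of_surjective
      (Ideal.Quotient.mk (vanishingIdeal ℂ X)) Ideal.Quotient.mk_surjective
      (mem_nonZeroDivisors_of_ne_zero hp0) (Ideal.Quotient.eq_zero_iff_mem.2 hp)
    rw [h0] at h1
    unfold zariskiDim at h
    rw [h] at h1
    exact absurd h1 (by
      rw [not_le]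
      exact_mod_cast Nat.lt_succ_self (Nat.card F))
  · intro h
    unfold zariskiDim
    rw [h, ringKrullDim_eq_of_ringEquiv (RingEquiv.quotientBot _), h0]

theorem zariskiDim_coordProj_iff {E : Type*} [Finite E] (V : Set (E → ℂ)) (I : Set E) :
    zariskiDim (coordProj I V) = (I.ncard : WithBot ℕ∞) ↔
      AlgebraicIndependent ℂ
        (fun i : I ↦ Ideal.Quotient.mk (vanishingIdeal ℂ V) (X (i : E))) := by
  have hc : I.ncard = Nat.card I := (Nat.card_coe_set_eq I).symm
  rw [hc, zariskiDim_eq_card_iff, algebraicIndependent_iff, Submodule.eq_bot_iff]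
  refine forall_congr' fun p ↦ imp_congr ?_ Iff.rfl
  have h1 : aeval (fun i : I ↦ Ideal.Quotient.mk (vanishingIdeal ℂ V) (X (i : E))) p =
      Ideal.Quotient.mk (vanishingIdeal ℂ V) (rename (Subtype.val : I → E) p) := by
    have : (aeval (fun i : I ↦ Ideal.Quotient.mk (vanishingIdeal ℂ V) (X (i : E)))) =
        (Ideal.Quotient.mkₐ ℂ (vanishingIdeal ℂ V)).comp (rename (Subtype.val : I → E)) := by
      ext i; simp
    rw [this]; rfl
  rw [h1, Ideal.Quotient.eq_zero_iff_mem, mem_vanishingIdeal_iff, mem_vanishingIdeal_iff]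
  simp only [coordProj, Set.forall_mem_image, aeval_rename]
  rfl

/-- The algebraic matroid of an irreducible variety `V` in `ℂ^E` (`E` finite): a set `I` of
coordinates is independent iff the projection of `V` to `ℂ^I` has dimension `|I|`. -/
noncomputable def algebraicMatroid {E : Type*} [Finite E] (V : Set (E → ℂ))
    (hV : (vanishingIdeal ℂ V).IsPrime) : Matroid E :=
  Matroid.ofExistsMatroid Set.univ
    (fun I ↦ zariskiDim (coordProj I V) = (I.ncard : WithBot ℕ∞)) <| by
      have : IsDomain (MvPolynomial E ℂ ⧸ vanishingIdeal ℂ V) :=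
        (Ideal.Quotient.isDomain_iff_prime _).2 hV
      have : FaithfulSMul ℂ (MvPolynomial E ℂ ⧸ vanishingIdeal ℂ V) :=
        (faithfulSMul_iff_algebraMap_injective ℂ (MvPolynomial E ℂ ⧸ vanishingIdeal ℂ V)).2
          (algebraMap ℂ (MvPolynomial E ℂ ⧸ vanishingIdeal ℂ V)).injective
      refine ⟨(AlgebraicIndependent.matroid ℂ (MvPolynomial E ℂ ⧸ vanishingIdeal ℂ V)).comap
        (fun e ↦ Ideal.Quotient.mk (vanishingIdeal ℂ V) (X e)), by simp, fun I ↦ ?_⟩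
      rw [zariskiDim_coordProj_iff, Matroid.comap_indep_iff,
        AlgebraicIndependent.matroid_indep_iff]
      constructor
      · rintro ⟨h, hinj⟩
        have := h.comp (fun i : I ↦ ⟨_, Set.mem_image_of_mem _ i.2⟩)
          (fun i j hij ↦ Subtype.ext (hinj i.2 j.2 (congrArg Subtype.val hij)))
        exact this
      · intro h
        refine ⟨?_, fun i hi j hj hij ↦ congrArg Subtype.val
          (h.injective (a₁ := ⟨i, hi⟩) (a₂ := ⟨j, hj⟩) hij)⟩
        have h2 := h.coe_range
        rw [show Set.range (fun i : I ↦ Ideal.Quotient.mk (vanishingIdeal ℂ V) (X (i : E))) =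
          (fun e ↦ Ideal.Quotient.mk (vanishingIdeal ℂ V) (X e)) '' I by
            rw [Set.image_eq_range]] at h2
        exact h2

/-! ### The Cayley-Menger variety -/

/-- The edges of the complete graph on `n` vertices. -/
abbrev KEdge (n : ℕ) : Type := (SimpleGraph.completeGraph (Fin n)).edgeSet

/-- The map sending `n` points of `ℝ^d` to their pairwise squared Euclidean distances. -/
noncomputable def sqDistMap (d n : ℕ) (x : Fin n → EuclideanSpace ℝ (Fin d)) : KEdge n → ℝ :=
  fun e ↦ Sym2.lift ⟨fun i j ↦ ‖x i - x j‖ ^ 2, fun i j ↦ by simp only [norm_sub_rev]⟩ (e : Sym2 (Fin n))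

/-- The Cayley-Menger variety: the Zariski closure in `ℂ^E`, where `E` is the edge set of `K_n`,
of the set of vectors of pairwise squared distances of `n` points of `ℝ^d`. -/
def cayleyMenger (d n : ℕ) : Set (KEdge n → ℂ) :=
  zariskiClosure (Set.range fun (x : Fin n → EuclideanSpace ℝ (Fin d)) (e : KEdge n) ↦
    (sqDistMap d n x e : ℂ))

theorem cayleyMenger_isPrime (d n : ℕ) : (vanishingIdeal ℂ (cayleyMenger d n)).IsPrime := by
  have hcl : vanishingIdeal ℂ (cayleyMenger d n) = vanishingIdeal ℂ
      (Set.range fun (x : Fin n → EuclideanSpace ℝ (Fin d)) (e : KEdge n) ↦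
        (sqDistMap d n x e : ℂ)) :=
    zeroLocus_vanishingIdeal_galoisConnection.u_l_u_eq_u _
  let g : Sym2 (Fin n) → MvPolynomial (Fin n × Fin d) ℂ :=
    Sym2.lift ⟨fun i j ↦ ∑ k, (X (i, k) - X (j, k)) ^ 2, fun i j ↦
      Finset.sum_congr rfl fun k _ ↦ by ring⟩
  let φ : MvPolynomial (KEdge n) ℂ →ₐ[ℂ] MvPolynomial (Fin n × Fin d) ℂ :=
    aeval fun e ↦ g e
  have hφ : ∀ (x : Fin n → EuclideanSpace ℝ (Fin d)) (p : MvPolynomial (KEdge n) ℂ),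
      aeval (fun e : KEdge n ↦ (sqDistMap d n x e : ℂ)) p =
        eval (fun ik : Fin n × Fin d ↦ (x ik.1 ik.2 : ℂ)) (φ p) := by
    intro x p
    have h : aeval (fun e : KEdge n ↦ (sqDistMap d n x e : ℂ)) =
        (aeval (R := ℂ) (fun ik : Fin n × Fin d ↦ (x ik.1 ik.2 : ℂ))).comp φ := by
      ext ⟨e, he⟩
      induction e with
      | _ i j =>
        simp [φ, g, sqDistMap, EuclideanSpace.norm_sq_eq]
    rw [h]
    simp
  have hker : vanishingIdeal ℂ (cayleyMenger d n) = RingHom.ker φ.toRingHom := by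
    rw [hcl]
    ext p
    rw [mem_vanishingIdeal_iff, Set.forall_mem_range, RingHom.mem_ker]
    constructor
    · intro h
      refine funext_set (fun _ ↦ Set.range ((↑) : ℝ → ℂ))
        (fun _ ↦ Set.infinite_range_of_injective Complex.ofReal_injective) fun y hy ↦ ?_
      choose z hz using fun ik ↦ hy ik (Set.mem_univ _)
      have := h (fun i ↦ WithLp.toLp 2 fun k ↦ z (i, k))
      rw [hφ] at this
      have hy' : (fun ik : Fin n × Fin d ↦ ((z (ik.1, ik.2) : ℝ) : ℂ)) = y := _root_.funext hz
      simp only [hy'] at this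
      simpa using this
    · intro h x
      rw [hφ]
      have h' : φ p = 0 := h
      rw [h', map_zero]
  rw [hker]
  exact RingHom.ker_isPrime _

/-- The algebraic matroid of the Cayley-Menger variety, on the edge set of `K_n`. -/
noncomputable def cayleyMengerMatroid (d n : ℕ) : Matroid (KEdge n) :=
  algebraicMatroid (cayleyMenger d n) (cayleyMenger_isPrime d n)

/-- The edge set of a graph on `n` vertices, as a set of edges of `K_n`. -/
def edgesIn {n : ℕ} (G : SimpleGraph (Fin n)) : Set (KEdge n) :=
  Subtype.val ⁻¹' G.edgeSet

/-! ### The graphic matroid -/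

section Graphic

variable {V : Type*}

theorem fromEdgeSet_insert (S : Set (Sym2 V)) (u v : V) :
    SimpleGraph.fromEdgeSet (insert s(u, v) S) =
      SimpleGraph.fromEdgeSet S ⊔ SimpleGraph.edge u v := by
  rw [SimpleGraph.edge, ← SimpleGraph.fromEdgeSet_union, Set.union_singleton]

theorem reachable_sup_edge {G : SimpleGraph V} {u v x y : V}
    (h : (G ⊔ SimpleGraph.edge u v).Reachable x y) :
    G.Reachable x y ∨ ((G.Reachable x u ∨ G.Reachable x v) ∧
      (G.Reachable y u ∨ G.Reachable y v)) := by
  obtain ⟨p⟩ := h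
  induction p with
  | nil => exact Or.inl (SimpleGraph.Reachable.refl _)
  | @cons a b c hab _ ih =>
    rw [SimpleGraph.sup_adj, SimpleGraph.edge_adj] at hab
    rcases hab with hab | ⟨hab, -⟩
    · have hr := hab.reachable
      rcases ih with ih | ⟨ih1, ih2⟩
      · exact Or.inl (hr.trans ih)
      · exact Or.inr ⟨ih1.imp hr.trans hr.trans, ih2⟩
    · have ha : G.Reachable a u ∨ G.Reachable a v := by
        rcases hab with ⟨rfl, rfl⟩ | ⟨rfl, rfl⟩
        · exact Or.inl (SimpleGraph.Reachable.refl _)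
        · exact Or.inr (SimpleGraph.Reachable.refl _)
      refine Or.inr ⟨ha, ?_⟩
      rcases ih with ih | ⟨-, ih2⟩
      · rcases hab with ⟨rfl, rfl⟩ | ⟨rfl, rfl⟩
        · exact Or.inr ih.symm
        · exact Or.inl ih.symm
      · exact ih2

theorem card_component_le_sup_edge [Finite V] (G : SimpleGraph V) (u v : V) :
    Nat.card G.ConnectedComponent ≤
      Nat.card (G ⊔ SimpleGraph.edge u v).ConnectedComponent + 1 := by
  classical
  rw [← Finite.card_option]
  let f : G.ConnectedComponent → Option (G ⊔ SimpleGraph.edge u v).ConnectedComponent :=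
    fun c ↦ if c = G.connectedComponentMk v then none
      else some (c.map (SimpleGraph.Hom.ofLE le_sup_left))
  refine Nat.card_le_card_of_injective f fun c c' h ↦ ?_
  by_cases h1 : c = G.connectedComponentMk v <;> by_cases h2 : c' = G.connectedComponentMk v
  · rw [h1, h2]
  · simp [f, h1, h2] at h
  · simp [f, h1, h2] at h
  · simp only [f, h1, h2, if_false, Option.some.injEq] at h
    induction c using SimpleGraph.ConnectedComponent.ind with | _ x
    induction c' using SimpleGraph.ConnectedComponent.ind with | _ y
    simp only [SimpleGraph.ConnectedComponent.map_mk, SimpleGraph.ConnectedComponent.eq,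
      SimpleGraph.Hom.coe_ofLE, id] at h h1 h2 ⊢
    rcases reachable_sup_edge h with h | ⟨hx, hy⟩
    · exact h
    · exact (hx.resolve_right h1).trans (hy.resolve_right h2).symm

theorem card_le_ncard_add_components [Finite V] (S : Set (Sym2 V)) :
    Nat.card V ≤ S.ncard + Nat.card (SimpleGraph.fromEdgeSet S).ConnectedComponent := by
  induction S, S.toFinite using Set.Finite.induction_on with
  | empty =>
    rw [Set.ncard_empty, zero_add]
    refine Nat.card_le_card_of_injective
      (SimpleGraph.fromEdgeSet (∅ : Set (Sym2 V))).connectedComponentMk fun x y h ↦ ?_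
    simpa using SimpleGraph.ConnectedComponent.eq.1 h
  | @insert e S he hS ih =>
    induction e with
    | _ u v =>
      rw [Set.ncard_insert_of_notMem he hS, fromEdgeSet_insert]
      have := card_component_le_sup_edge (SimpleGraph.fromEdgeSet S) u v
      omega

theorem ncard_add_components_le [Finite V] (S : Set (Sym2 V)) (hd : ∀ e ∈ S, ¬ e.IsDiag)
    (hS : (SimpleGraph.fromEdgeSet S).IsAcyclic) :
    S.ncard + Nat.card (SimpleGraph.fromEdgeSet S).ConnectedComponent ≤ Nat.card V := by
  induction S, S.toFinite using Set.Finite.induction_on with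
  | empty =>
    rw [Set.ncard_empty, zero_add]
    exact Nat.card_le_card_of_surjective _
      (fun c ↦ c.exists_rep)
  | @insert e S he hfin ih =>
    induction e with
    | _ u v =>
      rw [Set.ncard_insert_of_notMem he hfin]
      rw [fromEdgeSet_insert] at hS ⊢
      obtain ⟨h1, h2⟩ := SimpleGraph.isAcyclic_sup_fromEdgeSet_iff.1 hS
      have huv : u ≠ v := by simpa using hd s(u, v) (Set.mem_insert _ _)
      have hnr : ¬ (SimpleGraph.fromEdgeSet S).Reachable u v := by
        intro h
        rcases h2 h with h | h
        · exact huv h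
        · exact he ((SimpleGraph.fromEdgeSet_adj S).1 h).1
      have ih' := ih (fun e h ↦ hd e (Set.mem_insert_of_mem _ h)) h1
      have hle : SimpleGraph.fromEdgeSet S ≤
        SimpleGraph.fromEdgeSet S ⊔ SimpleGraph.edge u v := le_sup_left
      have hlt : Nat.card (SimpleGraph.fromEdgeSet S ⊔ SimpleGraph.edge u v).ConnectedComponent <
          Nat.card (SimpleGraph.fromEdgeSet S).ConnectedComponent := by
        refine lt_of_le_of_ne (SimpleGraph.ConnectedComponent.card_le_card_of_le hle) fun heq ↦ ?_
        have hb := (Function.Surjective.bijective_of_nat_card_le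
          (SimpleGraph.ConnectedComponent.surjective_map_ofLE hle) heq.ge)
        refine hnr (SimpleGraph.ConnectedComponent.eq.1 (hb.1 ?_))
        simp only [SimpleGraph.ConnectedComponent.map_mk, SimpleGraph.ConnectedComponent.eq,
          SimpleGraph.Hom.coe_ofLE, id]
        exact SimpleGraph.Adj.reachable (by simp [SimpleGraph.edge_adj, huv])
      omega

/-- The graphic matroid of a finite simple graph `G`: a set of edges is independent iff it forms
a forest. -/
noncomputable def graphicMatroid [Finite V] (G : SimpleGraph V) : Matroid G.edgeSet :=
  (IndepMatroid.ofFinite (E := Set.univ) Set.finite_univ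
    (fun I : Set G.edgeSet ↦ (SimpleGraph.fromEdgeSet (Subtype.val '' I)).IsAcyclic)
    (by simp)
    (fun I J hJ hIJ ↦ hJ.anti (SimpleGraph.fromEdgeSet_mono (Set.image_mono hIJ)))
    (by
      intro I J hI hJ hlt
      by_contra! hcon
      have hd : ∀ K : Set G.edgeSet, ∀ e ∈ (Subtype.val '' K : Set (Sym2 V)), ¬ e.IsDiag := by
        rintro K _ ⟨e, -, rfl⟩
        exact G.not_isDiag_of_mem_edgeSet e.2
      have h1 := ncard_add_components_le _ (hd J) hJ
      have h2 := card_le_ncard_add_components (Subtype.val '' I : Set (Sym2 V))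
      rw [Set.ncard_image_of_injective _ Subtype.val_injective] at h1 h2
      have hadj : ∀ a b, (SimpleGraph.fromEdgeSet (Subtype.val '' J)).Adj a b →
          (SimpleGraph.fromEdgeSet (Subtype.val '' I)).Reachable a b := by
        intro a b hab
        obtain ⟨⟨e, heJ, hab'⟩, hne⟩ := (SimpleGraph.fromEdgeSet_adj _).1 hab
        by_cases heI : e ∈ I
        · exact SimpleGraph.Adj.reachable
            ((SimpleGraph.fromEdgeSet_adj _).2 ⟨⟨e, heI, hab'⟩, hne⟩)
        · by_contra hnr
          refine hcon e heJ heI ?_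
          rw [Set.image_insert_eq, hab', fromEdgeSet_insert]
          exact hI.sup_edge_of_not_reachable hnr
      have hreach : ∀ a b, (SimpleGraph.fromEdgeSet (Subtype.val '' J)).Reachable a b →
          (SimpleGraph.fromEdgeSet (Subtype.val '' I)).Reachable a b := by
        rintro a b ⟨p⟩
        induction p with
        | nil => exact SimpleGraph.Reachable.refl _
        | cons h _ ih => exact (hadj _ _ h).trans ih
      have h3 : Nat.card (SimpleGraph.fromEdgeSet (Subtype.val '' I)).ConnectedComponent ≤
          Nat.card (SimpleGraph.fromEdgeSet (Subtype.val '' J)).ConnectedComponent := by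
        refine Nat.card_le_card_of_surjective (Quot.map id hreach) fun c ↦ ?_
        obtain ⟨x, rfl⟩ := c.exists_rep
        exact ⟨Quot.mk _ x, rfl⟩
      omega)
    (fun I _ ↦ Set.subset_univ I)).matroid

end Graphic

/-! ### The matroid of a submodular function -/

section Submodular

variable {E : Type*}

/-- The sets declared independent by a set function `f`: `I` is empty, or every nonempty
`I' ⊆ I` satisfies `|I'| ≤ f(I')`. -/
def SubmodularIndep (f : Set E → ℤ) (I : Set E) : Prop :=
  I = ∅ ∨ ∀ I' ⊆ I, I'.Nonempty → (I'.ncard : ℤ) ≤ f I'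

theorem submodularIndep_iff (f : Set E → ℤ) (I : Set E) :
    SubmodularIndep f I ↔ ∀ I' ⊆ I, I'.Nonempty → (I'.ncard : ℤ) ≤ f I' := by
  refine ⟨?_, Or.inr⟩
  rintro (rfl | h)
  · intro I' h1 h2
    exact absurd (Set.subset_empty_iff.1 h1) h2.ne_empty
  · exact h

theorem SubmodularIndep.subset {f : Set E → ℤ} {I J : Set E} (hJ : SubmodularIndep f J)
    (hIJ : I ⊆ J) : SubmodularIndep f I := by
  rw [submodularIndep_iff] at hJ ⊢
  exact fun I' h ↦ hJ I' (h.trans hIJ)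

theorem submodular_card_bound [Finite E] (f : Set E → ℤ)
    (hsub : ∀ S T : Set E, f (S ∪ T) + f (S ∩ T) ≤ f S + f T)
    (hmono : ∀ S T : Set E, S ⊆ T → f S ≤ f T) (k : ℕ) :
    ∀ I J : Set E, I.ncard ≤ k → SubmodularIndep f I → SubmodularIndep f J →
      (∀ e ∈ J, e ∉ I → ∃ T ⊆ I, T.Nonempty ∧ f T = T.ncard ∧ f (insert e T) = T.ncard) →
      J.ncard ≤ I.ncard := by
  induction k with
  | zero =>
    intro I J hI _ _ hJI
    refine Set.ncard_le_ncard fun e he ↦ ?_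
    by_contra heI
    obtain ⟨T, hT, hTn, -⟩ := hJI e he heI
    have : I = ∅ := (Set.ncard_eq_zero).1 (by omega)
    exact hTn.ne_empty (Set.subset_empty_iff.1 (this ▸ hT))
  | succ k ih =>
    intro I J hIk hI hJ hJI
    by_cases hsubset : J ⊆ I
    · exact Set.ncard_le_ncard hsubset
    obtain ⟨e₀, he₀, he₀I⟩ := Set.not_subset.1 hsubset
    obtain ⟨T₀, hT₀⟩ := hJI e₀ he₀ he₀I
    obtain ⟨T, hTmax⟩ := (Set.toFinite {T : Set E | T ⊆ I ∧ T.Nonempty ∧ f T = T.ncard}).exists_maximal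
      ⟨T₀, hT₀.1, hT₀.2.1, hT₀.2.2.1⟩
    obtain ⟨hTI, hTn, hTt⟩ := hTmax.prop
    have hI' := (submodularIndep_iff f I).1 hI
    have hJ' := (submodularIndep_iff f J).1 hJ
    set A : Set E := {x | x ∈ J ∧ x ∉ I ∧ f (insert x T) = f T} with hA
    have hTA : ∀ B : Set E, B ⊆ A → f (T ∪ B) = f T := by
      intro B
      induction B, B.toFinite using Set.Finite.induction_on with
      | empty => simp
      | @insert x B hx hB ihB =>
        intro hBA
        have h1 := ihB ((Set.subset_insert _ _).trans hBA)
        have h2 : f (insert x T) = f T := (hBA (Set.mem_insert _ _)).2.2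
        have h3 := hsub (T ∪ B) (insert x T)
        have h4 : T ∪ B ∪ insert x T = T ∪ insert x B := by
          ext y; simp only [Set.mem_union, Set.mem_insert_iff]; tauto
        have h5 : f T ≤ f ((T ∪ B) ∩ insert x T) :=
          hmono _ _ (Set.subset_inter Set.subset_union_left (Set.subset_insert _ _))
        have h6 : f T ≤ f (T ∪ insert x B) := hmono _ _ Set.subset_union_left
        rw [h4] at h3
        omega
    have hJ1 : (J ∩ (T ∪ A)).ncard ≤ T.ncard := by
      rcases Set.eq_empty_or_nonempty (J ∩ (T ∪ A)) with h | h
      · simp [h]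
      · have h1 := hJ' _ Set.inter_subset_left h
        have h2 := hmono (J ∩ (T ∪ A)) (T ∪ A) Set.inter_subset_right
        have h3 := hTA A subset_rfl
        omega
    have hcI : (I \ T).ncard + T.ncard = I.ncard := Set.ncard_sdiff_add_ncard_of_subset hTI
    have hTpos : 0 < T.ncard := (Set.ncard_pos).2 hTn
    have hcJ : (J ∩ (T ∪ A)).ncard + (J \ (T ∪ A)).ncard = J.ncard :=
      Set.ncard_inter_add_ncard_sdiff_eq_ncard J (T ∪ A)
    have hrec := ih (I \ T) (J \ (T ∪ A)) (by omega) (hI.subset Set.sdiff_subset)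
      (hJ.subset Set.sdiff_subset) (by
        rintro x ⟨hxJ, hxTA⟩ hxI
        have hxI' : x ∉ I := fun h ↦ hxI ⟨h, fun h' ↦ hxTA (Or.inl h')⟩
        obtain ⟨S, hSI, hSn, hSt, hSx⟩ := hJI x hxJ hxI'
        refine ⟨S, fun y hy ↦ ⟨hSI hy, fun hyT ↦ ?_⟩, hSn, hSt, hSx⟩
        have hne : (T ∩ S).Nonempty := ⟨y, hyT, hy⟩
        have h1 := hsub T S
        have h2 := hI' (T ∩ S) (Set.inter_subset_left.trans hTI) hne
        have h3 := hI' (T ∪ S) (Set.union_subset hTI hSI) (hTn.mono Set.subset_union_left)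
        have h4 := Set.ncard_union_add_ncard_inter T S
        have h5 : f (T ∪ S) = (T ∪ S).ncard := by omega
        have hST : S ⊆ T := by
          have := hTmax.le_of_ge (y := T ∪ S)
            ⟨Set.union_subset hTI hSI, hTn.mono Set.subset_union_left, h5⟩ Set.subset_union_left
          exact Set.subset_union_right.trans this
        refine hxTA (Or.inr ⟨hxJ, hxI', ?_⟩)
        have h6 := hsub T (insert x S)
        have h7 : T ∪ insert x S = insert x T := by
          rw [Set.union_insert, Set.union_eq_self_of_subset_right hST]
        have h8 : f S ≤ f (T ∩ insert x S) :=
          hmono _ _ (Set.subset_inter hST (Set.subset_insert _ _))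
        have h9 : f T ≤ f (insert x T) := hmono _ _ (Set.subset_insert _ _)
        rw [h7] at h6
        omega)
    omega

/-- The matroid that a submodular, monotone, integer-valued set function on a finite
set determines. -/
noncomputable def submodularMatroid [Finite E] (f : Set E → ℤ)
    (hsub : ∀ S T : Set E, f (S ∪ T) + f (S ∩ T) ≤ f S + f T)
    (hmono : ∀ S T : Set E, S ⊆ T → f S ≤ f T) : Matroid E :=
  (IndepMatroid.ofFinite (E := Set.univ) Set.finite_univ (SubmodularIndep f) (Or.inl rfl)
    (fun _ _ hJ hIJ ↦ hJ.subset hIJ)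
    (by
      intro I J hI hJ hlt
      by_contra! hcon
      refine hlt.not_ge (submodular_card_bound f hsub hmono _ I J le_rfl hI hJ fun e heJ heI ↦ ?_)
      have hdep := hcon e heJ heI
      rw [submodularIndep_iff] at hdep hI hJ
      push Not at hdep
      obtain ⟨S, hS, hSn, hSlt⟩ := hdep
      have heS : e ∈ S := by
        by_contra heS
        exact absurd (hI S ((Set.subset_insert_iff_of_notMem heS).1 hS) hSn) (by omega)
      have hcard : (S \ {e}).ncard + 1 = S.ncard := Set.ncard_sdiff_singleton_add_one heS
      have hsubI : S \ {e} ⊆ I := by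
        rintro y ⟨hy, hye⟩
        exact (hS hy).resolve_left hye
      have hins : insert e (S \ {e}) = S := by
        rw [Set.insert_sdiff_singleton, Set.insert_eq_of_mem heS]
      have hne : (S \ {e}).Nonempty := by
        by_contra hemp
        rw [Set.not_nonempty_iff_eq_empty] at hemp
        rw [hemp] at hins
        have h1 := hJ S (by rw [← hins]; simpa using heJ) hSn
        omega
      have h1 := hI _ hsubI hne
      have h2 := hmono (S \ {e}) S Set.sdiff_subset
      refine ⟨S \ {e}, hsubI, hne, by omega, ?_⟩
      rw [hins]
      omega)
    (fun I _ ↦ Set.subset_univ I)).matroid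

/-- The rank function of a matroid on a finite set, as an integer. -/
noncomputable def rankFn (M : Matroid E) (S : Set E) : ℤ := ((M.eRk S).toNat : ℤ)

theorem coe_toNat_eRk [Finite E] (M : Matroid E) (S : Set E) :
    (((M.eRk S).toNat : ℕ) : ℕ∞) = M.eRk S :=
  ENat.natCast_toNat (ne_top_of_le_ne_top (Set.encard_ne_top_iff.2 S.toFinite) (M.eRk_le_encard S))

theorem rankFn_submodular [Finite E] (M : Matroid E) (S T : Set E) :
    rankFn M (S ∪ T) + rankFn M (S ∩ T) ≤ rankFn M S + rankFn M T := by
  have h := M.eRk_inter_add_eRk_union_le S T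
  rw [← coe_toNat_eRk M (S ∩ T), ← coe_toNat_eRk M (S ∪ T), ← coe_toNat_eRk M S,
    ← coe_toNat_eRk M T] at h
  unfold rankFn
  norm_cast at h ⊢
  omega

theorem rankFn_mono [Finite E] (M : Matroid E) (S T : Set E) (h : S ⊆ T) :
    rankFn M S ≤ rankFn M T := by
  have h := M.eRk_mono h
  rw [← coe_toNat_eRk M S, ← coe_toNat_eRk M T] at h
  unfold rankFn
  exact_mod_cast h

/-- For a matroid `M` with rank function `r`, the matroid of the submodular function `2r - 1`. -/
noncomputable def twiceRankSubOneMatroid [Finite E] (M : Matroid E) : Matroid E :=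
  submodularMatroid (fun S ↦ 2 * rankFn M S - 1)
    (fun S T ↦ by have := rankFn_submodular M S T; omega)
    (fun S T h ↦ by have := rankFn_mono M S T h; omega)

end Submodular

end Rigidity

/-! This is the Pollaczek-Geiringer–Laman theorem. Three conditions on an edge set `I` are shown to
be equivalent by a cycle of implications: algebraic independence, independence for `2r - 1`, and
Laman sparsity.

Over the complex numbers, squared distance factors: with `z = x + iy` and `w = (x - iy)/2` it is
twice the product of the `z`-difference and the `w`-difference. All edge differences are linear in
those of a spanning forest with `r` edges, and `(z, w) ↦ (z/d, dw)` preserves every product. The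
squared lengths are therefore polynomials in `2r - 1` parameters, and transcendence degree bounds an
independent set (`ncard_le_of_cayleyMengerMatroid_indep`).

A nonempty forest with `r` edges covers at least `r + 1` vertices, so `2r - 1 ≤ 2m - 3` and sparsity
follows (`sparse_of_twiceRankSubOne`).

A sparse set is stress-free in some configuration, by induction along reversed Henneberg moves
(`Sparse.exists_stressFree`). The delicate case is a vertex of degree three, where a deleted star is
replaced by one edge between its neighbours (`Sparse.exists_replacement_edge`).

Stress-freeness says that the length map is a submersion, so its image contains an open set and no
nonzero polynomial vanishes on it (`StressFree.cayleyMengerMatroid_indep`).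

Bases have `2n - 3` elements: sparsity gives the upper bound, and all edges meeting two fixed
vertices form an independent set of that size. -/

namespace Rigidity

/-! ### The infinitesimal rigidity map in isotropic coordinates -/

section EdgeForm

variable {V : Type*}

/-- In isotropic coordinates `(z, w)` on the plane, squared distance is `z * w` up to scaling.
This is the polar form of the squared length of an edge, with respect to two configurations. -/
def edgeForm (p q : V → ℂ × ℂ) : Sym2 V → ℂ :=
  Sym2.lift ⟨fun i j ↦ ((p i).1 - (p j).1) * ((q i).2 - (q j).2) +
    ((p i).2 - (p j).2) * ((q i).1 - (q j).1), fun i j ↦ by ring⟩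

@[simp] theorem edgeForm_mk (p q : V → ℂ × ℂ) (i j : V) :
    edgeForm p q s(i, j) = ((p i).1 - (p j).1) * ((q i).2 - (q j).2) +
      ((p i).2 - (p j).2) * ((q i).1 - (q j).1) := rfl

/-- `edgeForm p` as a linear map. -/
def edgeFormₗ (p : V → ℂ × ℂ) : (V → ℂ × ℂ) →ₗ[ℂ] (Sym2 V → ℂ) where
  toFun := edgeForm p
  map_add' q r := by
    ext e; induction e with | _ i j
    simp only [edgeForm_mk, Pi.add_apply, Prod.fst_add, Prod.snd_add]; ring
  map_smul' c q := by
    ext e; induction e with | _ i j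
    simp only [edgeForm_mk, Pi.smul_apply, Prod.smul_fst, Prod.smul_snd, smul_eq_mul,
      RingHom.id_apply]; ring

@[simp] theorem edgeFormₗ_apply (p q : V → ℂ × ℂ) : edgeFormₗ p q = edgeForm p q := rfl

theorem continuous_edgeForm (q : V → ℂ × ℂ) (e : Sym2 V) :
    Continuous fun p : V → ℂ × ℂ ↦ edgeForm p q e := by
  induction e with | _ i j
  simp only [edgeForm_mk]; fun_prop

theorem edgeForm_congr {p p' q q' : V → ℂ × ℂ} {e : Sym2 V} (hp : ∀ v ∈ e, p v = p' v)
    (hq : ∀ v ∈ e, q v = q' v) : edgeForm p q e = edgeForm p' q' e := by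
  induction e with | _ i j
  simp [hp i (by simp), hp j (by simp), hq i (by simp), hq j (by simp)]

/-- The configuration `p` is infinitesimally stress-free on the edges `I`: every assignment of
rates of change of the squared lengths of these edges is realized by a motion. -/
def StressFree (p : V → ℂ × ℂ) (I : Set (Sym2 V)) : Prop :=
  ∀ t : Sym2 V → ℂ, ∃ u, ∀ e ∈ I, edgeForm p u e = t e

/-- Full rank is an open condition: motions `u f` dual to the edges at `p` give a matrix that is the
identity at `p`, and its determinant stays nonzero nearby. -/
theorem StressFree.eventually {p : V → ℂ × ℂ} {I : Set (Sym2 V)} (hI : I.Finite)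
    (h : StressFree p I) : ∀ᶠ p' in nhds p, StressFree p' I := by
  classical
  have := hI.fintype
  choose u hu using fun f : I ↦ h (Pi.single (f : Sym2 V) 1)
  let M : (V → ℂ × ℂ) → Matrix I I ℂ := fun p' ↦ Matrix.of fun e f ↦ edgeForm p' (u f) e
  have hM : M p = 1 := by
    ext e f
    simp only [M, Matrix.of_apply, hu f e e.2, Matrix.one_apply, Pi.single_apply,
      Subtype.coe_inj]
  have hc : Continuous fun p' ↦ (M p').det :=
    Continuous.matrix_det (continuous_matrix fun e f ↦ continuous_edgeForm (u f) e)
  have hne : ∀ᶠ p' in nhds p, (M p').det ≠ 0 :=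
    hc.continuousAt.eventually_ne (by rw [hM, Matrix.det_one]; exact one_ne_zero)
  filter_upwards [hne] with p' hp' t
  have hunit : IsUnit (M p').det := isUnit_iff_ne_zero.2 hp'
  let c : I → ℂ := (M p')⁻¹.mulVec fun e ↦ t e
  have hc : (M p').mulVec c = fun e : I ↦ t e := by
    simp [c, Matrix.mulVec_mulVec, Matrix.mul_nonsing_inv _ hunit]
  refine ⟨∑ f, c f • u f, fun e he ↦ ?_⟩
  have := congrFun hc ⟨e, he⟩
  rw [← edgeFormₗ_apply, map_sum, Finset.sum_apply]
  simp only [map_smul, edgeFormₗ_apply, Pi.smul_apply, smul_eq_mul]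
  rw [← this]
  simp only [Matrix.mulVec, dotProduct, M, Matrix.of_apply]
  exact Finset.sum_congr rfl fun f _ ↦ mul_comm _ _

/-- Infinitely many points of a line through `p` stay stress-free, while `φ` has finitely many
roots. Hence a nondegeneracy condition that is a nonzero polynomial along the line can be added for
free. -/
theorem StressFree.exists_perturb [Finite V] {p : V → ℂ × ℂ} {I : Set (Sym2 V)}
    (h : StressFree p I) (q : V → ℂ × ℂ) {φ : Polynomial ℂ} (hφ : φ ≠ 0) :
    ∃ s : ℂ, StressFree (p + s • q) I ∧ φ.eval s ≠ 0 := by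
  have hc : Continuous fun s : ℂ ↦ p + s • q := by fun_prop
  have h1 : ∀ᶠ s in nhds (0 : ℂ), StressFree (p + s • q) I :=
    hc.tendsto' 0 p (by simp) (h.eventually I.toFinite)
  have h2 : {s | StressFree (p + s • q) I}.Infinite := infinite_of_mem_nhds 0 h1
  obtain ⟨s, hs, hs'⟩ := (h2.sdiff (Polynomial.finite_setOfPred_isRoot hφ)).nonempty
  exact ⟨s, hs, hs'⟩

/-- The signed area (up to scaling) of the triangle with the three given vertices. -/
def area (x y z : ℂ × ℂ) : ℂ := (x.1 - y.1) * (x.2 - z.2) - (x.2 - y.2) * (x.1 - z.1)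

theorem StressFree.exists_ne [Finite V] {p : V → ℂ × ℂ} {I : Set (Sym2 V)}
    (h : StressFree p I) {a b : V} (hab : a ≠ b) : ∃ p', StressFree p' I ∧ p' a ≠ p' b := by
  classical
  have hφ : (Polynomial.X + Polynomial.C ((p a).1 - (p b).1)) ≠ 0 :=
    (Polynomial.monic_X_add_C _).ne_zero
  obtain ⟨s, hs, hs'⟩ := h.exists_perturb (Pi.single a (1, 0)) hφ
  refine ⟨_, hs, fun heq ↦ hs' ?_⟩
  have := congrArg Prod.fst heq
  simp [hab.symm] at this
  simp only [Polynomial.eval_add, Polynomial.eval_X, Polynomial.eval_C]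
  linear_combination this

theorem StressFree.exists_area_ne_zero [Finite V] {p : V → ℂ × ℂ} {I : Set (Sym2 V)}
    (h : StressFree p I) {a b c : V} (hab : a ≠ b) (hac : a ≠ c) (hbc : b ≠ c) :
    ∃ p', StressFree p' I ∧ area (p' a) (p' b) (p' c) ≠ 0 := by
  classical
  obtain ⟨x, hx⟩ : ∃ x, x = (p a).1 - (p b).1 := ⟨_, rfl⟩
  obtain ⟨y, hy⟩ : ∃ y, y = (p a).2 - (p c).2 := ⟨_, rfl⟩
  obtain ⟨k, hk⟩ : ∃ k, k = ((p a).2 - (p b).2) * ((p a).1 - (p c).1) := ⟨_, rfl⟩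
  -- Moving `b` by `(-s, 0)` and `c` by `(0, -s)` turns the area into `(x + s)(y + s) - k`, which is
  -- monic in `s`.
  have hφ : (Polynomial.X ^ 2 + (Polynomial.C (x + y) * Polynomial.X +
      Polynomial.C (x * y - k))) ≠ 0 := by
    apply Polynomial.Monic.ne_zero
    apply Polynomial.monic_X_pow_add
    exact (Polynomial.degree_linear_le).trans_lt (by norm_num)
  obtain ⟨s, hs, hs'⟩ := h.exists_perturb (Pi.single b (-1, 0) + Pi.single c (0, -1)) hφ
  refine ⟨_, hs, fun heq ↦ hs' ?_⟩
  simp [area, hab, hac, hbc, hbc.symm] at heq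
  simp only [Polynomial.eval_add, Polynomial.eval_pow, Polynomial.eval_mul, Polynomial.eval_X,
    Polynomial.eval_C, hx, hy, hk]
  linear_combination heq

/-! ### Attaching a vertex by one, two or three edges -/

theorem exists_linear_solution {r s : ℂ × ℂ} (h : r.1 * s.2 - r.2 * s.1 ≠ 0) (x y : ℂ) :
    ∃ u : ℂ × ℂ, r.1 * u.2 + r.2 * u.1 = x ∧ s.1 * u.2 + s.2 * u.1 = y := by
  refine ⟨((r.1 * y - s.1 * x) / (r.1 * s.2 - r.2 * s.1),
    (s.2 * x - r.2 * y) / (r.1 * s.2 - r.2 * s.1)), ?_, ?_⟩ <;>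
  · rw [mul_div_assoc', mul_div_assoc', ← add_div, div_eq_iff h]
    ring

theorem exists_area_ne_zero_of_ne {x y : ℂ × ℂ} (h : x ≠ y) : ∃ z, area z x y ≠ 0 := by
  by_contra! hz
  have h1 := hz (x + (1, 0))
  have h2 := hz (x + (0, 1))
  simp [area] at h1 h2
  exact h (Prod.ext (by linear_combination -h2) (by linear_combination h1))

/-- A configuration placing the new vertex `v`. -/
theorem stressFree_extend [DecidableEq V] {p : V → ℂ × ℂ} {I J : Set (Sym2 V)} {v : V} (x : ℂ × ℂ)
    (hI : ∀ e ∈ I, v ∉ e)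
    (h : ∀ t : Sym2 V → ℂ, ∃ u, (∀ e ∈ I, edgeForm p u e = t e) ∧
      ∃ y, ∀ e ∈ J, edgeForm (Function.update p v x) (Function.update u v y) e = t e) :
    StressFree (Function.update p v x) (I ∪ J) := by
  intro t
  obtain ⟨u, hu, y, hy⟩ := h t
  refine ⟨Function.update u v y, fun e he ↦ he.elim (fun he ↦ ?_) (hy e)⟩
  rw [← hu e he]
  have hne : ∀ w ∈ e, w ≠ v := fun w hw hwv ↦ hI e he (hwv ▸ hw)
  exact edgeForm_congr (fun w hw ↦ by simp [hne w hw]) (fun w hw ↦ by simp [hne w hw])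

theorem StressFree.extend_one [Finite V] {p : V → ℂ × ℂ} {I : Set (Sym2 V)} (h : StressFree p I)
    {v a : V} (hI : ∀ e ∈ I, v ∉ e) (ha : a ≠ v) : ∃ p', StressFree p' (I ∪ {s(v, a)}) := by
  classical
  refine ⟨_, stressFree_extend (p := p) (p a + (1, 0)) hI fun t ↦ ?_⟩
  obtain ⟨u, hu⟩ := h t
  refine ⟨u, hu, u a + (0, t s(v, a)), ?_⟩
  simp [ha]

/-- With `v` off the line through `a` and `b`, the two new edges impose independent linear equations
on the velocity of `v`. -/
theorem StressFree.extend_two [Finite V] {p : V → ℂ × ℂ} {I : Set (Sym2 V)} (h : StressFree p I)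
    {v a b : V} (hI : ∀ e ∈ I, v ∉ e) (ha : a ≠ v) (hb : b ≠ v) (hab : a ≠ b) :
    ∃ p', StressFree p' (I ∪ {s(v, a), s(v, b)}) := by
  classical
  obtain ⟨p, h, hp⟩ := h.exists_ne hab
  obtain ⟨x, hx⟩ := exists_area_ne_zero_of_ne hp
  refine ⟨_, stressFree_extend (p := p) x hI fun t ↦ ?_⟩
  obtain ⟨u, hu⟩ := h t
  obtain ⟨y, hy1, hy2⟩ := exists_linear_solution (r := x - p a) (s := x - p b) hx
    (t s(v, a) + ((x - p a).1 * (u a).2 + (x - p a).2 * (u a).1))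
    (t s(v, b) + ((x - p b).1 * (u b).2 + (x - p b).2 * (u b).1))
  refine ⟨u, hu, y, ?_⟩
  simp only [Prod.fst_sub, Prod.snd_sub] at hy1 hy2
  simp only [Set.mem_insert_iff, Set.mem_singleton_iff, forall_eq_or_imp, forall_eq, edgeForm_mk,
    Function.update_self, Function.update_of_ne ha, Function.update_of_ne hb]
  constructor
  · linear_combination hy1
  · linear_combination hy2

/-- With `v` at the midpoint of `a` and `b`, the rates on `va` and `vb` sum to half the rate on
`ab`, whatever the velocity of `v`. Prescribing the rate on `ab` thus settles one equation, and the
edges to `a` and `c` determine the velocity since `c` is off the line `ab`. -/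
theorem StressFree.extend_three [Finite V] {p : V → ℂ × ℂ} {I : Set (Sym2 V)} {v a b c : V}
    (h : StressFree p (insert s(a, b) I)) (habI : s(a, b) ∉ I) (hI : ∀ e ∈ I, v ∉ e) (ha : a ≠ v) (hb : b ≠ v)
    (hc : c ≠ v) (hab : a ≠ b) (hac : a ≠ c) (hbc : b ≠ c) :
    ∃ p', StressFree p' (I ∪ {s(v, a), s(v, b), s(v, c)}) := by
  classical
  obtain ⟨p, h, hp⟩ := h.exists_area_ne_zero hab hac hbc
  set x : ℂ × ℂ := (((p a).1 + (p b).1) / 2, ((p a).2 + (p b).2) / 2) with hx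
  refine ⟨_, stressFree_extend (p := p) x hI fun t ↦ ?_⟩
  -- The value on `ab` is the one forced by the midpoint relation.
  obtain ⟨u, hu⟩ := h (Function.update t s(a, b) (2 * (t s(v, a) + t s(v, b))))
  obtain ⟨u, hu, huab⟩ : ∃ u, (∀ e ∈ I, edgeForm p u e = t e) ∧
      edgeForm p u s(a, b) = 2 * (t s(v, a) + t s(v, b)) := by
    refine ⟨u, fun e he ↦ ?_, ?_⟩
    · rw [hu e (Or.inr he), Function.update_of_ne (ne_of_mem_of_not_mem he habI)]
    · rw [hu _ (Or.inl rfl), Function.update_self]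
  obtain ⟨y, hy1, hy2⟩ := exists_linear_solution (r := x - p a) (s := x - p c) (by
      intro h0
      apply hp
      simp only [area, hx, Prod.fst_sub, Prod.snd_sub] at h0 ⊢
      linear_combination -2 * h0)
    (t s(v, a) + ((x - p a).1 * (u a).2 + (x - p a).2 * (u a).1))
    (t s(v, c) + ((x - p c).1 * (u c).2 + (x - p c).2 * (u c).1))
  refine ⟨u, hu, y, ?_⟩
  simp only [Prod.fst_sub, Prod.snd_sub, hx, edgeForm_mk] at hy1 hy2 huab
  simp only [Set.mem_insert_iff, Set.mem_singleton_iff, forall_eq_or_imp, forall_eq, edgeForm_mk,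
    Function.update_self, Function.update_of_ne ha, Function.update_of_ne hb,
    Function.update_of_ne hc, hx]
  refine ⟨?_, ?_, ?_⟩
  · linear_combination hy1
  · linear_combination -hy1 + huab / 2
  · linear_combination hy2

end EdgeForm

/-! ### Sparse edge sets and Henneberg moves -/

section Sparse

variable {V : Type*}

/-- The vertices covered by a set of edges. -/
def covered (S : Set (Sym2 V)) : Set V := {v | ∃ e ∈ S, v ∈ e}

theorem covered_mono {S T : Set (Sym2 V)} (h : S ⊆ T) : covered S ⊆ covered T :=
  fun _ ⟨e, he, hv⟩ ↦ ⟨e, h he, hv⟩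

theorem covered_union (S T : Set (Sym2 V)) : covered (S ∪ T) = covered S ∪ covered T := by
  ext v; simp only [covered, Set.mem_union, Set.mem_ofPred_eq, or_and_right, exists_or]

/-- Laman's bound for a set of edges. -/
noncomputable def lamanBound (S : Set (Sym2 V)) : ℤ := 2 * ((covered S).ncard : ℤ) - 3

theorem lamanBound_mono [Finite V] (S T : Set (Sym2 V)) (h : S ⊆ T) :
    lamanBound S ≤ lamanBound T := by
  have := Set.ncard_le_ncard (covered_mono h)
  unfold lamanBound; omega

theorem lamanBound_submodular [Finite V] (S T : Set (Sym2 V)) :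
    lamanBound (S ∪ T) + lamanBound (S ∩ T) ≤ lamanBound S + lamanBound T := by
  have h1 : covered (S ∩ T) ⊆ covered S ∩ covered T :=
    Set.subset_inter (covered_mono Set.inter_subset_left) (covered_mono Set.inter_subset_right)
  have h2 := Set.ncard_le_ncard h1
  have h3 := Set.ncard_union_add_ncard_inter (covered S) (covered T)
  unfold lamanBound
  rw [covered_union]; omega

/-- A set of edges all of whose nonempty subsets satisfy Laman's bound. -/
def Sparse (I : Set (Sym2 V)) : Prop :=
  ∀ I' ⊆ I, I'.Nonempty → (I'.ncard : ℤ) ≤ lamanBound I'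

theorem Sparse.subset {I J : Set (Sym2 V)} (hJ : Sparse J) (h : I ⊆ J) : Sparse I :=
  fun I' hI' ↦ hJ I' (hI'.trans h)

/-- The matroid of sparse sets of edges. -/
noncomputable def lamanMatroid (V : Type*) [Finite V] : Matroid (Sym2 V) :=
  submodularMatroid lamanBound lamanBound_submodular lamanBound_mono

theorem lamanMatroid_indep [Finite V] {I : Set (Sym2 V)} :
    (lamanMatroid V).Indep I ↔ Sparse I := submodularIndep_iff _ _

theorem covered_singleton (a b : V) : covered {s(a, b)} = {a, b} := by
  ext v; simp [covered]

theorem Sparse.not_isDiag {I : Set (Sym2 V)} (hI : Sparse I) {e : Sym2 V}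
    (he : e ∈ I) : ¬ e.IsDiag := by
  induction e with | _ a b
  rintro hab
  have hab : a = b := hab
  have := hI {s(a, b)} (by simpa using he) (by simp)
  simp [lamanBound, covered_singleton, hab] at this

/-- One edge covers two vertices, with bound `1`; two or more distinct edges cover at least three,
with bound at least `3`. -/
theorem sparse_of_ncard_le_three [Finite V] {T : Set (Sym2 V)} (hT : T.ncard ≤ 3)
    (hd : ∀ e ∈ T, ¬ e.IsDiag) : Sparse T := by
  intro S hS ⟨e, he⟩
  have hS3 : S.ncard ≤ 3 := (Set.ncard_le_ncard hS).trans hT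
  have hsub : covered {e} ⊆ covered S := covered_mono (by simpa using he)
  have hnd := hd e (hS he)
  induction e with | _ a b
  rw [covered_singleton] at hsub
  have h2 : ({a, b} : Set V).ncard = 2 := Set.ncard_pair hnd
  by_cases hone : S = {s(a, b)}
  · simp [hone, lamanBound, covered_singleton, h2]
  have h3 : 3 ≤ (covered S).ncard := by
    obtain ⟨f, hf, hne⟩ : ∃ f ∈ S, f ≠ s(a, b) := by
      by_contra! h
      exact hone (Set.eq_singleton_iff_unique_mem.2 ⟨he, h⟩)
    have hfd := hd f (hS hf)
    obtain ⟨c, hc, hca, hcb⟩ : ∃ c ∈ f, c ≠ a ∧ c ≠ b := by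
      induction f with | _ x y
      by_contra! h
      have hx := h x (by simp)
      have hy := h y (by simp)
      have hxy : x ≠ y := hfd
      apply hne
      rw [Sym2.eq_iff]
      by_cases hxa : x = a
      · by_cases hya : y = a
        · exact absurd (hxa.trans hya.symm) hxy
        · exact Or.inl ⟨hxa, hy hya⟩
      · by_cases hya : y = a
        · exact Or.inr ⟨hx hxa, hya⟩
        · exact absurd ((hx hxa).trans (hy hya).symm) hxy
    have hins : insert c {a, b} ⊆ covered S := Set.insert_subset ⟨f, hf, hc⟩ hsub
    have := Set.ncard_le_ncard hins
    rw [Set.ncard_insert_of_notMem (by simp [hca, hcb]), h2] at this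
    exact this
  unfold lamanBound; omega

/-- Some vertex covered by a nonempty sparse set of edges has degree at most three. -/
theorem Sparse.exists_degree_le_three [Finite V] {I : Set (Sym2 V)} (hI : Sparse I)
    (hne : I.Nonempty) :
    ∃ v, 1 ≤ {e ∈ I | v ∈ e}.ncard ∧ {e ∈ I | v ∈ e}.ncard ≤ 3 := by
  classical
  have := Fintype.ofFinite V
  by_contra! hcon
  have hb := hI I subset_rfl hne
  -- Double count incidences: if all `m` covered vertices had degree at least four, then `4m ≤ 2|I|
  -- ≤ 2(2m - 3)`.
  have hcount := Finset.sum_card_bipartiteAbove_eq_sum_card_bipartiteBelow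
    (s := (covered I).toFinset) (t := I.toFinset) (fun v e ↦ v ∈ e)
  have h1 : ∀ v ∈ (covered I).toFinset,
      4 ≤ (Finset.bipartiteAbove (fun v e ↦ v ∈ e) I.toFinset v).card := by
    intro v hv
    obtain ⟨e, he, hve⟩ := Set.mem_toFinset.1 hv
    have heq : {e ∈ I | v ∈ e}.ncard =
        (Finset.bipartiteAbove (fun v e ↦ v ∈ e) I.toFinset v).card := by
      rw [← Set.ncard_coe_finset]; congr 1; ext e; simp
    rw [← heq]
    exact hcon v ((Set.ncard_pos (Set.toFinite _)).2 ⟨e, he, hve⟩)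
  have h2 : ∀ e ∈ I.toFinset,
      (Finset.bipartiteBelow (fun v e ↦ v ∈ e) (covered I).toFinset e).card = 2 := by
    intro e he
    rw [Set.mem_toFinset] at he
    rw [← Sym2.card_toFinset_of_not_isDiag e (hI.not_isDiag he)]
    congr 1; ext v
    simp only [Finset.mem_bipartiteBelow, Set.mem_toFinset, Sym2.mem_toFinset]
    exact ⟨fun h ↦ h.2, fun h ↦ ⟨⟨e, he, h⟩, h⟩⟩
  have h3 := Finset.card_nsmul_le_sum _ _ _ h1
  rw [hcount, Finset.sum_congr rfl h2] at h3
  simp only [smul_eq_mul, Finset.sum_const] at h3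
  rw [lamanBound, Set.ncard_eq_toFinset_card', Set.ncard_eq_toFinset_card'] at hb
  omega

/-- The reverse of the Henneberg move that subdivides an edge and attaches a third one. -/
theorem Sparse.exists_replacement_edge [Finite V] {I : Set (Sym2 V)} {v a b c : V}
    (ha : a ≠ v) (hb : b ≠ v) (hc : c ≠ v) (hab : a ≠ b) (hac : a ≠ c) (hbc : b ≠ c)
    (hI : ∀ e ∈ I, v ∉ e) (h : Sparse (I ∪ {s(v, a), s(v, b), s(v, c)})) :
    ∃ e ∈ ({s(a, b), s(a, c), s(b, c)} : Set (Sym2 V)), e ∉ I ∧ Sparse (insert e I) := by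
  by_contra! hcon
  set T : Set (Sym2 V) := {s(a, b), s(a, c), s(b, c)} with hT
  set S : Set (Sym2 V) := {s(v, a), s(v, b), s(v, c)} with hS
  set M := lamanMatroid V
  have hMI : M.Indep I := lamanMatroid_indep.2 (h.subset Set.subset_union_left)
  have hTcard : T.ncard = 3 :=
    Set.ncard_eq_three.2 ⟨_, _, _, by simp [hbc, hac], by simp [hab, hac],
      by simp [hab]; tauto, hT⟩
  have hScard : S.ncard = 3 :=
    Set.ncard_eq_three.2 ⟨_, _, _, by simp [hab, ha], by simp [hac, ha], by simp [hbc, hb], hS⟩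
  -- If no triangle edge can be added to `I`, the whole triangle lies in its closure.
  have hTcl : T ⊆ M.closure I := by
    intro e he
    by_contra hecl
    have heI : e ∉ I := fun h ↦ hecl (M.mem_closure_of_mem h hMI.subset_ground)
    exact hcon e he heI (lamanMatroid_indep.1 ((hMI.notMem_closure_iff_of_notMem heI (Set.mem_univ e)).1 hecl))
  have hMT : M.Indep T := lamanMatroid_indep.2 <| sparse_of_ncard_le_three hTcard.le (by
    simp [hT, hab, hac, hbc])
  obtain ⟨J, hJ, hTJ⟩ := hMT.subset_isBasis_of_subset hTcl (M.closure_subset_ground I)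
  have hIS : Disjoint I S := by
    rw [Set.disjoint_left]
    intro e heI heS
    apply hI e heI
    simp only [hS, Set.mem_insert_iff, Set.mem_singleton_iff] at heS
    rcases heS with rfl | rfl | rfl <;> simp
  have hJI : J.encard = I.encard := hJ.encard_eq_encard hMI.isBasis_closure
  -- Swapping `I` for a basis `J` of its closure containing the triangle keeps rank and size, so `J
  -- ∪ S` is still independent. It contains a `K₄` on `v, a, b, c`, whose six edges exceed `2 · 4 -
  -- 3`.
  have hrk : M.eRk (J ∪ S) = M.eRk (I ∪ S) := by
    rw [← M.eRk_union_closure_left_eq J S, hJ.closure_eq_closure, M.closure_closure,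
      M.eRk_union_closure_left_eq I S]
  have hMJS : M.Indep (J ∪ S) := by
    rw [Matroid.indep_iff_eRk_eq_encard_of_finite (Set.toFinite _)]
    refine le_antisymm (M.eRk_le_encard _) ?_
    rw [hrk, (lamanMatroid_indep.2 h).eRk_eq_encard, Set.encard_union_eq hIS, ← hJI]
    exact Set.encard_union_le J S
  have hTS : Sparse (T ∪ S) :=
    (lamanMatroid_indep.1 hMJS).subset (Set.union_subset_union_left S hTJ)
  have hbound := hTS _ subset_rfl ⟨s(a, b), Or.inl (by simp [hT])⟩
  have hdisj : Disjoint T S := by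
    rw [Set.disjoint_left]
    intro e heT heS
    have hv : v ∈ e := by
      simp only [hS, Set.mem_insert_iff, Set.mem_singleton_iff] at heS
      rcases heS with rfl | rfl | rfl <;> simp
    simp only [hT, Set.mem_insert_iff, Set.mem_singleton_iff] at heT
    rcases heT with rfl | rfl | rfl <;> simp [ha.symm, hb.symm, hc.symm] at hv
  rw [Set.ncard_union_eq hdisj, hTcard, hScard, lamanBound] at hbound
  have hcov : covered (T ∪ S) ⊆ insert v (insert a {b, c}) := by
    rintro x ⟨e, he, hx⟩
    simp only [hT, hS, Set.mem_union, Set.mem_insert_iff, Set.mem_singleton_iff] at he ⊢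
    rcases he with (rfl | rfl | rfl) | (rfl | rfl | rfl) <;> rw [Sym2.mem_iff] at hx <;> tauto
  have h4 := Set.ncard_le_ncard hcov
  have h5 := Set.ncard_insert_le v (insert a {b, c})
  have h6 := Set.ncard_insert_le a {b, c}
  have h7 := Set.ncard_insert_le b {c}
  rw [Set.ncard_singleton] at h7
  omega

/-- Sparse sets of edges are infinitesimally stress-free in some configuration. -/
theorem Sparse.exists_stressFree [Finite V] {I : Set (Sym2 V)} (h : Sparse I) :
    ∃ p, StressFree p I := by
  induction hk : I.ncard using Nat.strong_induction_on generalizing I with | _ k ih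
  rcases I.eq_empty_or_nonempty with rfl | hne
  · exact ⟨0, fun t ↦ ⟨0, by simp⟩⟩
  obtain ⟨v, hv1, hv3⟩ := h.exists_degree_le_three hne
  set J := {e ∈ I | v ∈ e} with hJ
  set K := {e ∈ I | v ∉ e} with hK
  have hKJ : K ∪ J = I := by
    ext e; simp only [hJ, hK, Set.mem_union, Set.mem_ofPred_eq]; tauto
  have hdisj : Disjoint K J := by
    rw [Set.disjoint_left]; exact fun e he he' ↦ he.2 he'.2
  have hcard : K.ncard + J.ncard = I.ncard := by rw [← Set.ncard_union_eq hdisj, hKJ]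
  have hKv : ∀ e ∈ K, v ∉ e := fun e he ↦ he.2
  have hKs : Sparse K := h.subset (Set.sep_subset _ _)
  have hform : ∀ e ∈ J, ∃ a, a ≠ v ∧ e = s(v, a) := by
    rintro e ⟨he, a, rfl⟩
    exact ⟨a, fun hav ↦ h.not_isDiag he (by simp [hav]), rfl⟩
  rw [← hKJ] at h ⊢
  obtain h1 | h2 | h3 : J.ncard = 1 ∨ J.ncard = 2 ∨ J.ncard = 3 := by omega
  · obtain ⟨e, he⟩ := Set.ncard_eq_one.1 h1
    obtain ⟨a, ha, rfl⟩ := hform e (by simp [he])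
    obtain ⟨p, hp⟩ := ih _ (by omega) hKs rfl
    rw [he]
    exact hp.extend_one hKv ha
  · obtain ⟨e, f, hef, he⟩ := Set.ncard_eq_two.1 h2
    obtain ⟨a, ha, rfl⟩ := hform e (by simp [he])
    obtain ⟨b, hb, rfl⟩ := hform f (by simp [he])
    obtain ⟨p, hp⟩ := ih _ (by omega) hKs rfl
    rw [he]
    exact hp.extend_two hKv ha hb (fun hab ↦ hef (by rw [hab]))
  · obtain ⟨e, f, g, hef, heg, hfg, he⟩ := Set.ncard_eq_three.1 h3
    obtain ⟨a, ha, rfl⟩ := hform e (by simp [he])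
    obtain ⟨b, hb, rfl⟩ := hform f (by simp [he])
    obtain ⟨c, hc, rfl⟩ := hform g (by simp [he])
    have hab : a ≠ b := fun hab ↦ hef (by rw [hab])
    have hac : a ≠ c := fun hac ↦ heg (by rw [hac])
    have hbc : b ≠ c := fun hbc ↦ hfg (by rw [hbc])
    rw [he] at h ⊢
    -- Three edges go and one comes, so the induction on the number of edges applies.
    obtain ⟨e, heT, heK, hes⟩ := h.exists_replacement_edge ha hb hc hab hac hbc hKv
    obtain ⟨p, hp⟩ := ih _ (by rw [Set.ncard_insert_of_notMem heK]; omega) hes rfl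
    rcases heT with rfl | rfl | rfl
    · exact hp.extend_three heK hKv ha hb hc hab hac hbc
    · rw [Set.pair_comm]
      exact hp.extend_three heK hKv ha hc hb hac hab hbc.symm
    · rw [Set.insert_comm, Set.pair_comm]
      exact hp.extend_three heK hKv hb hc ha hbc hab.symm hac.symm

end Sparse

/-! ### The algebraic matroid in isotropic coordinates -/

/-- A polynomial vanishing at all real points is zero, so real configurations may be replaced by
complex ones; a linear change of coordinates then makes them isotropic. -/
theorem vanishingIdeal_cayleyMenger {n : ℕ} (P : MvPolynomial (KEdge n) ℂ) :
    P ∈ vanishingIdeal ℂ (cayleyMenger 2 n) ↔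
      ∀ p : Fin n → ℂ × ℂ, eval (fun e : KEdge n ↦ edgeForm p p e) P = 0 := by
  have hcl : vanishingIdeal ℂ (cayleyMenger 2 n) = vanishingIdeal ℂ
      (Set.range fun (x : Fin n → EuclideanSpace ℝ (Fin 2)) (e : KEdge n) ↦
        (sqDistMap 2 n x e : ℂ)) :=
    zeroLocus_vanishingIdeal_galoisConnection.u_l_u_eq_u _
  have hreal : ∀ (x : Fin n → EuclideanSpace ℝ (Fin 2)) (e : KEdge n),
      (sqDistMap 2 n x e : ℂ) = edgeForm
        (fun i ↦ ((x i 0 : ℂ) + x i 1 * Complex.I, ((x i 0 : ℂ) - x i 1 * Complex.I) / 2))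
        (fun i ↦ ((x i 0 : ℂ) + x i 1 * Complex.I, ((x i 0 : ℂ) - x i 1 * Complex.I) / 2)) e := by
    rintro x ⟨e, he⟩
    induction e with | _ i j
    simp [sqDistMap, EuclideanSpace.norm_sq_eq]
    linear_combination (((x i 1 : ℂ) - x j 1) ^ 2) * Complex.I_sq
  rw [hcl, mem_vanishingIdeal_iff, Set.forall_mem_range]
  constructor
  · intro h p
    let g : Sym2 (Fin n) → MvPolynomial (Fin n × Fin 2) ℂ :=
      Sym2.lift ⟨fun i j ↦ ∑ k, (X (i, k) - X (j, k)) ^ 2, fun i j ↦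
        Finset.sum_congr rfl fun k _ ↦ by ring⟩
    have hg : ∀ (y : Fin n × Fin 2 → ℂ), eval y (bind₁ (fun e : KEdge n ↦ g e) P) =
        eval (fun e : KEdge n ↦ eval y (g e)) P := by
      intro y
      simpa using eval₂Hom_bind₁ (RingHom.id ℂ) y (fun e : KEdge n ↦ g e) P
    have hzero : bind₁ (fun e : KEdge n ↦ g e) P = 0 := by
      refine funext_set (fun _ ↦ Set.range ((↑) : ℝ → ℂ))
        (fun _ ↦ Set.infinite_range_of_injective Complex.ofReal_injective) fun y hy ↦ ?_
      choose z hz using fun ik ↦ hy ik (Set.mem_univ _)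
      have := h (fun i ↦ WithLp.toLp 2 fun k ↦ z (i, k))
      rw [map_zero, hg, ← this]
      rw [aeval_eq_eval]
      congr 2
      ext ⟨e, he⟩
      induction e with | _ i j
      simp [g, sqDistMap, EuclideanSpace.norm_sq_eq, hz]
    -- This inverts `z = x + iy`, `w = (x - iy)/2`.
    have := hg (fun ik ↦ if ik.2 = 0 then ((p ik.1).1 + 2 * (p ik.1).2) / 2
      else ((p ik.1).1 - 2 * (p ik.1).2) / (2 * Complex.I))
    rw [hzero, map_zero] at this
    rw [this]
    congr 2
    ext ⟨e, he⟩
    induction e with | _ i j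
    simp [g]
    field_simp
    rw [Complex.I_sq]
    ring
  · intro h x
    rw [aeval_eq_eval]
    simp_rw [hreal]
    exact h _

theorem cayleyMengerMatroid_indep_iff {n : ℕ} (I : Set (KEdge n)) :
    (cayleyMengerMatroid 2 n).Indep I ↔ ∀ P : MvPolynomial I ℂ,
      (∀ p : Fin n → ℂ × ℂ, eval (fun e : I ↦ edgeForm p p (e : KEdge n)) P = 0) → P = 0 := by
  have h0 : (cayleyMengerMatroid 2 n).Indep I ↔
      zariskiDim (coordProj I (cayleyMenger 2 n)) = (I.ncard : WithBot ℕ∞) := by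
    rfl
  have hc : I.ncard = Nat.card I := (Nat.card_coe_set_eq I).symm
  rw [h0, hc, zariskiDim_eq_card_iff, Submodule.eq_bot_iff]
  refine forall_congr' fun P ↦ imp_congr ?_ Iff.rfl
  have h1 := vanishingIdeal_cayleyMenger (rename (Subtype.val : I → KEdge n) P)
  simp only [eval_rename] at h1
  rw [mem_vanishingIdeal_iff] at h1 ⊢
  simp only [coordProj, Set.forall_mem_image]
  simp only [aeval_rename] at h1
  exact h1

theorem eq_zero_of_eventually_eval_eq_zero {σ : Type*} [Finite σ] {P : MvPolynomial σ ℂ}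
    {x : σ → ℂ} (h : ∀ᶠ y in nhds x, eval y P = 0) : P = 0 := by
  have := Fintype.ofFinite σ
  rw [nhds_pi, Filter.eventually_iff, Filter.mem_pi'] at h
  obtain ⟨s, t, ht, hst⟩ := h
  refine funext_set t (fun i ↦ infinite_of_mem_nhds (x i) (ht i)) fun y hy ↦ ?_
  rw [map_zero]
  exact hst fun i _ ↦ hy i trivial

/-- The derivative of the length map at `p` is twice the polar form, hence surjective, so the image
of the map contains a neighbourhood on which `P` vanishes. -/
theorem StressFree.cayleyMengerMatroid_indep {n : ℕ} {p : Fin n → ℂ × ℂ} {I : Set (KEdge n)}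
    (h : StressFree p (Subtype.val '' I)) : (cayleyMengerMatroid 2 n).Indep I := by
  rw [cayleyMengerMatroid_indep_iff]
  intro P hP
  have := Fintype.ofFinite I
  let G : (Fin n → ℂ × ℂ) → I → ℂ := fun q e ↦ edgeForm q q (e : KEdge n)
  let L : (Fin n → ℂ × ℂ) →ₗ[ℂ] I → ℂ :=
    (LinearMap.funLeft ℂ ℂ fun e : I ↦ ((e : KEdge n) : Sym2 (Fin n))) ∘ₗ ((2 : ℂ) • edgeFormₗ p)
  have hL : ∀ u e, L u e = 2 * edgeForm p u (e : KEdge n) := fun u e ↦ rfl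
  have hG : HasStrictFDerivAt G (LinearMap.toContinuousLinearMap L) p := by
    rw [hasStrictFDerivAt_pi']
    rintro ⟨⟨e, he⟩, heI⟩
    induction e with | _ i j
    have hz : ∀ k : Fin n, HasStrictFDerivAt (fun q : Fin n → ℂ × ℂ ↦ (q k).1)
      ((ContinuousLinearMap.fst ℂ ℂ ℂ).comp (ContinuousLinearMap.proj k)) p :=
        fun k ↦ ((ContinuousLinearMap.fst ℂ ℂ ℂ).comp (ContinuousLinearMap.proj
          (φ := fun _ : Fin n ↦ ℂ × ℂ) k)).hasStrictFDerivAt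
    have hw : ∀ k : Fin n, HasStrictFDerivAt (fun q : Fin n → ℂ × ℂ ↦ (q k).2)
      ((ContinuousLinearMap.snd ℂ ℂ ℂ).comp (ContinuousLinearMap.proj k)) p :=
        fun k ↦ ((ContinuousLinearMap.snd ℂ ℂ ℂ).comp (ContinuousLinearMap.proj
          (φ := fun _ : Fin n ↦ ℂ × ℂ) k)).hasStrictFDerivAt
    have := (((hz i).sub (hz j)).mul ((hw i).sub (hw j))).const_mul (2 : ℂ)
    refine HasStrictFDerivAt.congr_fderiv (this.congr_of_eventuallyEq ?_) ?_
    · refine Filter.Eventually.of_forall fun q ↦ ?_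
      simp [G]; ring
    · ext u
      all_goals simp [hL]
      all_goals ring
  have hsurj : (LinearMap.toContinuousLinearMap L).range = ⊤ := by
    rw [LinearMap.range_eq_top]
    intro t
    classical
    obtain ⟨u, hu⟩ := h (fun e ↦ if he : ∃ e' : I, ((e' : KEdge n) : Sym2 (Fin n)) = e
      then t he.choose / 2 else 0)
    refine ⟨u, funext fun e ↦ ?_⟩
    have hex : ∃ e' : I, ((e' : KEdge n) : Sym2 (Fin n)) = (e : KEdge n) := ⟨e, rfl⟩
    have hch : hex.choose = e := Subtype.ext (Subtype.ext hex.choose_spec)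
    change L u e = t e
    rw [hL, hu _ ⟨e, e.2, rfl⟩, dif_pos hex, hch]
    ring
  have hmap := hG.map_nhds_eq_of_surj hsurj
  refine eq_zero_of_eventually_eval_eq_zero (x := G p) ?_
  rw [← hmap, Filter.eventually_map]
  exact Filter.Eventually.of_forall hP

/-! ### Rank in the graphic matroid -/

section GraphicRank

variable {V : Type*}

theorem graphicMatroid_indep_iff [Finite V] {G : SimpleGraph V} {I : Set G.edgeSet} :
    (graphicMatroid G).Indep I ↔ (SimpleGraph.fromEdgeSet (Subtype.val '' I)).IsAcyclic :=
  Iff.rfl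

theorem rankFn_eq_ncard {E : Type*} {M : Matroid E} {F I : Set E} (h : M.IsBasis F I) :
    rankFn M I = F.ncard := by
  rw [rankFn, h.eRk_eq_encard, Set.ncard_def]

theorem reachable_of_isBasis [Finite V] {G : SimpleGraph V} {F I : Set G.edgeSet}
    (h : (graphicMatroid G).IsBasis F I) {i j : V} {he : s(i, j) ∈ G.edgeSet}
    (hI : ⟨s(i, j), he⟩ ∈ I) : (SimpleGraph.fromEdgeSet (Subtype.val '' F)).Reachable i j := by
  by_contra hnr
  have hac : (graphicMatroid G).Indep (insert ⟨s(i, j), he⟩ F) := by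
    rw [graphicMatroid_indep_iff, Set.image_insert_eq, fromEdgeSet_insert]
    exact (graphicMatroid_indep_iff.1 h.indep).sup_edge_of_not_reachable hnr
  have hF := h.mem_of_insert_indep hI hac
  exact hnr (SimpleGraph.Adj.reachable ((SimpleGraph.fromEdgeSet_adj _).2
    ⟨⟨_, hF, rfl⟩, G.ne_of_adj he⟩))

/-- Each uncovered vertex is a component by itself and the covered ones give at least one more;
compare with the component count of a forest. -/
theorem ncard_lt_ncard_covered [Finite V] {S : Set (Sym2 V)} (hd : ∀ e ∈ S, ¬ e.IsDiag)
    (hS : (SimpleGraph.fromEdgeSet S).IsAcyclic) (hne : S.Nonempty) :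
    S.ncard + 1 ≤ (covered S).ncard := by
  classical
  have h1 := ncard_add_components_le S hd hS
  obtain ⟨e, he⟩ := hne
  obtain ⟨a, ha⟩ : ∃ a, a ∈ covered S := by
    induction e with | _ a b
    exact ⟨a, _, he, by simp⟩
  have hiso : ∀ x y, x ∉ covered S → (SimpleGraph.fromEdgeSet S).Reachable x y → x = y := by
    rintro x y hx ⟨p⟩
    cases p with
    | nil => rfl
    | cons h _ => exact absurd ⟨_, ((SimpleGraph.fromEdgeSet_adj S).1 h).1, by simp⟩ hx
  let f : Option ((covered S)ᶜ : Set V) → (SimpleGraph.fromEdgeSet S).ConnectedComponent :=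
    fun o ↦ (SimpleGraph.fromEdgeSet S).connectedComponentMk (o.elim a Subtype.val)
  have hf : Function.Injective f := by
    rintro (_ | x) (_ | y) h
    · rfl
    · exact absurd (hiso _ _ y.2 (SimpleGraph.ConnectedComponent.eq.1 h).symm ▸ ha) y.2
    · exact absurd (hiso _ _ x.2 (SimpleGraph.ConnectedComponent.eq.1 h) ▸ ha) x.2
    · exact congrArg some (Subtype.ext (hiso _ _ x.2 (SimpleGraph.ConnectedComponent.eq.1 h)))
  have h2 := Nat.card_le_card_of_injective f hf
  rw [Finite.card_option, Nat.card_coe_set_eq] at h2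
  have h3 := Set.ncard_add_ncard_compl (covered S)
  omega

end GraphicRank

theorem not_isDiag_of_mem_image {n : ℕ} {I : Set (KEdge n)} :
    ∀ e ∈ (Subtype.val '' I : Set (Sym2 (Fin n))), ¬ e.IsDiag := by
  rintro _ ⟨e, -, rfl⟩
  exact SimpleGraph.not_isDiag_of_mem_edgeSet _ e.2

theorem ncard_image_val {n : ℕ} (I : Set (KEdge n)) :
    (Subtype.val '' I : Set (Sym2 (Fin n))).ncard = I.ncard :=
  Set.ncard_image_of_injective _ Subtype.val_injective

theorem sparse_of_twiceRankSubOne {n : ℕ} {I : Set (KEdge n)}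
    (h : SubmodularIndep (fun S ↦ 2 * rankFn
      (graphicMatroid (SimpleGraph.completeGraph (Fin n))) S - 1) I) :
    Sparse (Subtype.val '' I : Set (Sym2 (Fin n))) := by
  intro S hS hne
  obtain ⟨J, hJ, rfl⟩ := Set.subset_image_iff.1 hS
  have hb := (submodularIndep_iff _ I).1 h J hJ (Set.image_nonempty.1 hne)
  obtain ⟨F, hF⟩ := (graphicMatroid (SimpleGraph.completeGraph (Fin n))).exists_isBasis J
    (Set.subset_univ _)
  rw [ncard_image_val]
  simp only [rankFn_eq_ncard hF] at hb
  have hFne : F.Nonempty := by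
    rw [Set.nonempty_iff_ne_empty]
    rintro rfl
    rw [Set.ncard_empty] at hb; omega
  have h1 := ncard_lt_ncard_covered not_isDiag_of_mem_image
    (graphicMatroid_indep_iff.1 hF.indep) (hFne.image _)
  have h2 := Set.ncard_le_ncard (covered_mono (Set.image_mono (f := Subtype.val) hF.subset))
  rw [ncard_image_val] at h1
  unfold lamanBound; omega

/-! ### Algebraic independence bounds the number of edges -/

/-- The difference of the values at `i` and `j`, as a linear form. -/
def vertexDiff {V : Type*} (i j : V) : (V → ℂ) →ₗ[ℂ] ℂ :=
  LinearMap.proj (R := ℂ) (φ := fun _ : V ↦ ℂ) i - LinearMap.proj (R := ℂ) (φ := fun _ : V ↦ ℂ) j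

@[simp] theorem vertexDiff_apply {V : Type*} (i j : V) (x : V → ℂ) :
    vertexDiff i j x = x i - x j := rfl

/-- The difference of the values at the endpoints of `e`, for some orientation of `e`. -/
noncomputable def edgeDiff {V : Type*} (e : Sym2 V) : (V → ℂ) →ₗ[ℂ] ℂ :=
  vertexDiff (Quot.out e).1 (Quot.out e).2

theorem edgeDiff_mk {V : Type*} (i j : V) :
    edgeDiff s(i, j) = vertexDiff i j ∨ edgeDiff s(i, j) = -vertexDiff i j := by
  have h : s((Quot.out s(i, j)).1, (Quot.out s(i, j)).2) = s(i, j) := Quot.out_eq _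
  unfold edgeDiff
  rcases Sym2.eq_iff.1 h with ⟨h1, h2⟩ | ⟨h1, h2⟩ <;> rw [h1, h2]
  · exact Or.inl rfl
  · exact Or.inr (LinearMap.ext fun x ↦ by simp)

/-- Both factors use the same orientation of `e`, so its arbitrary choice cancels. -/
theorem edgeForm_self_eq {V : Type*} (p : V → ℂ × ℂ) (e : Sym2 V) :
    edgeForm p p e = 2 * edgeDiff e (fun v ↦ (p v).1) * edgeDiff e (fun v ↦ (p v).2) := by
  induction e with | _ i j
  rcases edgeDiff_mk i j with h | h <;> simp [h] <;> ring

/-- Differences telescope along a path in `F`. -/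
theorem edgeDiff_mem_span {V : Type*} {F : Set (Sym2 V)} {i j : V}
    (h : (SimpleGraph.fromEdgeSet F).Reachable i j) :
    edgeDiff s(i, j) ∈ Submodule.span ℂ (edgeDiff '' F) := by
  have key : vertexDiff i j ∈ Submodule.span ℂ (edgeDiff '' F) := by
    obtain ⟨p⟩ := h
    induction p with
    | @nil a =>
      rw [show vertexDiff a a = 0 from LinearMap.ext fun x ↦ by simp]
      exact zero_mem _
    | @cons a b c hab _ ih =>
      rw [show vertexDiff a c = vertexDiff a b + vertexDiff b c from
        LinearMap.ext fun x ↦ by simp]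
      refine add_mem ?_ ih
      have hmem := Submodule.subset_span (R := ℂ)
        (Set.mem_image_of_mem edgeDiff ((SimpleGraph.fromEdgeSet_adj F).1 hab).1)
      rcases edgeDiff_mk a b with h | h <;> rw [h] at hmem
      · exact hmem
      · exact neg_mem_iff.1 hmem
  rcases edgeDiff_mk i j with h | h <;> rw [h]
  · exact key
  · exact neg_mem key

/-- An algebraically independent set of squared lengths is determined by twice as many
coordinates as there are edges in a spanning forest, one of which is removed by scaling. -/
theorem ncard_le_of_cayleyMengerMatroid_indep {n : ℕ} {I : Set (KEdge n)}
    (h : (cayleyMengerMatroid 2 n).Indep I) (hne : I.Nonempty) :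
    (I.ncard : ℤ) ≤
      2 * rankFn (graphicMatroid (SimpleGraph.completeGraph (Fin n))) I - 1 := by
  classical
  obtain ⟨F, hF⟩ := (graphicMatroid (SimpleGraph.completeGraph (Fin n))).exists_isBasis I
    (Set.subset_univ _)
  rw [rankFn_eq_ncard hF]
  have := Fintype.ofFinite F
  have := Fintype.ofFinite I
  have hspan : ∀ e : I, ∃ c : F → ℂ,
      ∑ f, c f • edgeDiff ((f : KEdge n) : Sym2 (Fin n)) = edgeDiff ((e : KEdge n) : Sym2 (Fin n)) := by
    rintro ⟨⟨e, he⟩, heI⟩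
    rw [← Submodule.mem_span_range_iff_exists_fun]
    induction e with | _ i j
    have := edgeDiff_mem_span (reachable_of_isBasis hF heI)
    rw [Set.image_image, Set.image_eq_range] at this
    exact this
  choose c hc using hspan
  have hc' : ∀ (e : I) x, edgeDiff ((e : KEdge n) : Sym2 (Fin n)) x =
      ∑ f, c e f * edgeDiff ((f : KEdge n) : Sym2 (Fin n)) x := by
    intro e x; rw [← hc]; simp
  obtain ⟨f₀⟩ : Nonempty F := by
    by_contra hemp
    rw [not_nonempty_iff] at hemp
    obtain ⟨⟨e, he⟩, heI⟩ := hne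
    have h0 := hc ⟨_, heI⟩
    induction e with | _ i j
    have hij : i ≠ j := ((SimpleGraph.mem_edgeSet _).1 he).ne
    simp only [Finset.univ_eq_empty, Finset.sum_empty] at h0
    have h1 := LinearMap.congr_fun h0 (Pi.single i 1)
    rcases edgeDiff_mk i j with h | h <;> rw [h] at h1 <;> simp [hij.symm] at h1
  let σ := F ⊕ {f : F // f ≠ f₀}
  -- The `z`-difference of `f₀` is normalized to `1`, which leaves `2|F| - 1` variables: all
  -- `w`-differences and the other `z`-differences.
  let Q : I → MvPolynomial σ ℂ := fun e ↦
    C 2 * (C (c e f₀) + ∑ f : {f : F // f ≠ f₀}, C (c e f) * X (Sum.inr f)) *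
      ∑ f, C (c e f) * X (Sum.inl f)
  have hQ : ∀ (p : Fin n → ℂ × ℂ) (d : ℂ),
      d = edgeDiff ((f₀ : KEdge n) : Sym2 (Fin n)) (fun v ↦ (p v).1) → d ≠ 0 → ∀ e : I,
      eval (Sum.elim (fun f : F ↦ d * edgeDiff ((f : KEdge n) : Sym2 (Fin n)) fun v ↦ (p v).2)
        (fun f : {f : F // f ≠ f₀} ↦ d⁻¹ * edgeDiff ((f : KEdge n) : Sym2 (Fin n)) fun v ↦ (p v).1)) (Q e) =
      edgeForm p p (e : KEdge n) := by
    intro p d hd hd0 e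
    rw [edgeForm_self_eq, hc', hc', Fintype.sum_eq_add_sum_subtype_ne _ f₀, ← hd]
    simp only [Q, map_mul, map_add, map_sum, eval_C, eval_X, Sum.elim_inl, Sum.elim_inr]
    simp only [mul_left_comm _ d, mul_left_comm _ d⁻¹, ← Finset.mul_sum]
    field_simp
  have hind : AlgebraicIndependent ℂ Q := by
    rw [algebraicIndependent_iff]
    intro P hP
    rw [cayleyMengerMatroid_indep_iff] at h
    refine h P ?_
    have hgen : ∀ p : Fin n → ℂ × ℂ,
        edgeDiff ((f₀ : KEdge n) : Sym2 (Fin n)) (fun v ↦ (p v).1) ≠ 0 →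
        eval (fun e : I ↦ edgeForm p p (e : KEdge n)) P = 0 := by
      intro p hp
      have h1 := congrArg (eval (Sum.elim
        (fun f : F ↦ edgeDiff ((f₀ : KEdge n) : Sym2 (Fin n)) (fun v ↦ (p v).1) *
          edgeDiff ((f : KEdge n) : Sym2 (Fin n)) fun v ↦ (p v).2)
        (fun f : {f : F // f ≠ f₀} ↦
          (edgeDiff ((f₀ : KEdge n) : Sym2 (Fin n)) (fun v ↦ (p v).1))⁻¹ *
          edgeDiff ((f : KEdge n) : Sym2 (Fin n)) fun v ↦ (p v).1))) hP
      rw [map_zero, ← MvPolynomial.aeval_eq_eval, ← AlgHom.comp_apply, comp_aeval,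
        aeval_eq_eval] at h1
      rw [← h1]
      congr 2
      ext e
      rw [aeval_eq_eval]
      exact (hQ p _ rfl hp e).symm
    intro p
    obtain ⟨i, hi⟩ : ∃ i, edgeDiff ((f₀ : KEdge n) : Sym2 (Fin n)) (Pi.single i 1) ≠ 0 := by
      obtain ⟨⟨⟨e, he⟩, heF⟩, hf⟩ : ∃ f, f = f₀ := ⟨f₀, rfl⟩
      rw [← hf]
      induction e with | _ i j
      have hij : i ≠ j := ((SimpleGraph.mem_edgeSet _).1 he).ne
      refine ⟨i, ?_⟩
      rcases edgeDiff_mk i j with h | h <;> simp [h, hij.symm]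
    by_cases hp : edgeDiff ((f₀ : KEdge n) : Sym2 (Fin n)) (fun v ↦ (p v).1) = 0
    -- Scaling needs the `z`-difference of `f₀` to be nonzero; the degenerate case is a limit of
    -- configurations where it is.
    · let q : ℂ → Fin n → ℂ × ℂ := fun s ↦ p + s • (Pi.single i (1, 0) : Fin n → ℂ × ℂ)
      have hq : Continuous q := by fun_prop
      have hqd : ∀ s, edgeDiff ((f₀ : KEdge n) : Sym2 (Fin n)) (fun v ↦ (q s v).1) =
          s * edgeDiff ((f₀ : KEdge n) : Sym2 (Fin n)) (Pi.single i 1) := by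
        intro s
        have : (fun v ↦ (q s v).1) = (fun v ↦ (p v).1) + s • Pi.single i 1 := by
          ext v
          by_cases hv : v = i
          · subst hv; simp [q]
          · simp [q, hv]
        rw [this, map_add, hp, zero_add, map_smul, smul_eq_mul]
      have hcont : Continuous fun s ↦ eval (fun e : I ↦ edgeForm (q s) (q s) (e : KEdge n)) P := by
        refine (MvPolynomial.continuous_eval P).comp (continuous_pi fun e ↦ ?_)
        obtain ⟨⟨e, he⟩, heI⟩ := e
        induction e with | _ a b
        simp only [edgeForm_mk]
        fun_prop
      have hzero := hcont.ext_on (dense_compl_singleton (0 : ℂ)) continuous_const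
        (g := fun _ ↦ (0 : ℂ)) fun s hs ↦ hgen (q s) (by rw [hqd]; exact mul_ne_zero hs hi)
      simpa [q] using congrFun hzero 0
    · exact hgen p hp
  have hcard := hind.cardinalMk_le_trdeg
  rw [MvPolynomial.trdeg_of_isDomain, Cardinal.lift_id, Cardinal.mk_fintype, Cardinal.mk_fintype,
    Nat.cast_le, Fintype.card_sum, Fintype.card_subtype_compl, Fintype.card_subtype_eq] at hcard
  have hpos : 0 < Fintype.card F := Fintype.card_pos_iff.2 ⟨f₀⟩
  rw [← Nat.card_coe_set_eq, ← Nat.card_coe_set_eq, Nat.card_eq_fintype_card,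
    Nat.card_eq_fintype_card]
  omega

/-- The forward direction applies the parameter count to every nonempty subset; the converse passes
through sparsity and a stress-free configuration. -/
theorem cayleyMengerMatroid_indep_iff_submodularIndep {n : ℕ} {I : Set (KEdge n)} :
    (cayleyMengerMatroid 2 n).Indep I ↔ SubmodularIndep (fun S ↦ 2 * rankFn
      (graphicMatroid (SimpleGraph.completeGraph (Fin n))) S - 1) I := by
  refine ⟨fun h ↦ (submodularIndep_iff _ I).2 fun J hJ hne ↦
    ncard_le_of_cayleyMengerMatroid_indep (h.subset hJ) hne, fun h ↦ ?_⟩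
  obtain ⟨p, hp⟩ := (sparse_of_twiceRankSubOne h).exists_stressFree
  exact hp.cayleyMengerMatroid_indep

theorem cayleyMengerMatroid_indep_iff_sparse {n : ℕ} {I : Set (KEdge n)} :
    (cayleyMengerMatroid 2 n).Indep I ↔ Sparse (Subtype.val '' I : Set (Sym2 (Fin n))) := by
  refine ⟨fun h ↦ sparse_of_twiceRankSubOne (cayleyMengerMatroid_indep_iff_submodularIndep.1 h),
    fun h ↦ ?_⟩
  obtain ⟨p, hp⟩ := h.exists_stressFree
  exact hp.cayleyMengerMatroid_indep

/-! ### Subgraph counts and bases -/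

/-- Isolated vertices only weaken the bound, so it suffices to test subgraphs spanned by their
edges. -/
theorem sparse_edgeSet_iff {V : Type*} [Finite V] (G : SimpleGraph V) :
    Sparse G.edgeSet ↔ ∀ H : G.Subgraph, 2 ≤ H.verts.ncard →
      (H.edgeSet.ncard : ℤ) ≤ 2 * (H.verts.ncard : ℤ) - 3 := by
  constructor
  · intro h H hH
    rcases H.edgeSet.eq_empty_or_nonempty with he | hne
    · rw [he, Set.ncard_empty]; omega
    have h1 := h _ H.edgeSet_subset hne
    have h2 : covered H.edgeSet ⊆ H.verts := fun v ⟨e, he, hv⟩ ↦ H.mem_verts_of_mem_edge he hv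
    have h3 := Set.ncard_le_ncard h2
    unfold lamanBound at h1; omega
  · intro h S hS ⟨e, he⟩
    let H : G.Subgraph :=
      { verts := covered S
        Adj := fun a b ↦ s(a, b) ∈ S
        adj_sub := fun hab ↦ hS hab
        edge_vert := fun hab ↦ ⟨_, hab, by simp⟩
        symm := ⟨fun a b hab ↦ Sym2.eq_swap (a := a) ▸ hab⟩ }
    have hH : H.edgeSet = S := by
      ext f; induction f with | _ a b
      rfl
    have h2 : 2 ≤ H.verts.ncard := by
      induction e with | _ a b
      rw [← Set.ncard_pair (G.ne_of_adj (hS he))]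
      refine Set.ncard_le_ncard ?_
      rintro x (rfl | rfl) <;> exact ⟨_, he, by simp⟩
    have := h H h2
    rwa [hH] at this

/-- All edges with an endpoint in `{a, b}`. -/
def doubleStar {V : Type*} (a b : V) : Set (Sym2 V) :=
  (fun k ↦ s(a, k)) '' {a}ᶜ ∪ (fun k ↦ s(b, k)) '' {a, b}ᶜ

theorem ncard_doubleStar {V : Type*} [Finite V] {a b : V} (hab : a ≠ b) :
    ((doubleStar a b).ncard : ℤ) = 2 * (Nat.card V : ℤ) - 3 := by
  have hdisj : Disjoint ((fun k ↦ s(a, k)) '' {a}ᶜ) ((fun k ↦ s(b, k)) '' ({a, b} : Set V)ᶜ) := by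
    rw [Set.disjoint_left]
    rintro _ ⟨k, -, rfl⟩ ⟨l, hl, hkl⟩
    have : a ∈ s(b, l) := by rw [show s(b, l) = s(a, k) from hkl]; simp
    simp only [Set.mem_compl_iff, Set.mem_insert_iff, Set.mem_singleton_iff, not_or] at hl
    rcases Sym2.mem_iff.1 this with h | h
    · exact hab h
    · exact hl.1 h.symm
  have hinj : ∀ c : V, Function.Injective fun k ↦ s(c, k) := fun c k l h ↦ Sym2.congr_right.1 h
  have h1 := Set.ncard_add_ncard_compl ({a} : Set V)
  have h2 := Set.ncard_add_ncard_compl ({a, b} : Set V)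
  rw [Set.ncard_singleton] at h1
  rw [Set.ncard_pair hab] at h2
  rw [doubleStar, Set.ncard_union_eq hdisj, Set.ncard_image_of_injective _ (hinj a),
    Set.ncard_image_of_injective _ (hinj b)]
  omega

theorem exists_stressFree_doubleStar {V : Type*} {a b : V} (hab : a ≠ b) :
    ∃ p, StressFree p (doubleStar a b) := by
  classical
  -- All remaining vertices may share one point, as no edge joins two of them. Each coordinate
  -- difference from `a` or `b` to that point has one zero entry, so the equations solve one at a
  -- time.
  refine ⟨fun k ↦ if k = a then (0, 0) else if k = b then (1, 1) else (1, 0), fun t ↦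
    ⟨fun k ↦ if k = a then (0, 0) else if k = b then (t s(a, b), 0) else
      (t s(a, b) - t s(b, k), t s(a, k)), ?_⟩⟩
  rintro _ (⟨k, hk, rfl⟩ | ⟨k, hk, rfl⟩)
  · by_cases hkb : k = b
    · simp [hkb, hab.symm]
    · have hka : k ≠ a := hk
      simp [hka, hkb]
  · simp only [Set.mem_compl_iff, Set.mem_insert_iff, Set.mem_singleton_iff, not_or] at hk
    simp [hk.1, hk.2, hab.symm]

theorem ncard_le_of_indep {n : ℕ} (hn : 2 ≤ n) {I : Set (KEdge n)}
    (h : (cayleyMengerMatroid 2 n).Indep I) : (I.ncard : ℤ) ≤ 2 * (n : ℤ) - 3 := by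
  rcases I.eq_empty_or_nonempty with rfl | hne
  · rw [Set.ncard_empty]; omega
  have h1 := cayleyMengerMatroid_indep_iff_sparse.1 h _ subset_rfl (hne.image _)
  have h2 := Set.ncard_le_card (covered (Subtype.val '' I : Set (Sym2 (Fin n))))
  rw [Nat.card_fin] at h2
  rw [ncard_image_val, lamanBound] at h1
  omega

theorem ncard_of_isBase {n : ℕ} (hn : 2 ≤ n) {B : Set (KEdge n)}
    (h : (cayleyMengerMatroid 2 n).IsBase B) : (B.ncard : ℤ) = 2 * (n : ℤ) - 3 := by
  refine le_antisymm (ncard_le_of_indep hn h.indep) ?_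
  have hab : (⟨0, by omega⟩ : Fin n) ≠ ⟨1, by omega⟩ := by simp
  have hcard := ncard_doubleStar hab
  obtain ⟨p, hp⟩ := exists_stressFree_doubleStar hab
  set D := doubleStar (⟨0, by omega⟩ : Fin n) ⟨1, by omega⟩ with hD
  have hDE : D ⊆ Set.range (Subtype.val : KEdge n → Sym2 (Fin n)) := by
    rw [Subtype.range_coe]
    rintro _ (⟨k, hk, rfl⟩ | ⟨k, hk, rfl⟩)
    · exact fun h ↦ hk h.symm
    · exact fun h ↦ hk (Or.inr h.symm)
  obtain ⟨J, hJ⟩ := Set.subset_range_iff_exists_image_eq.1 hDE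
  rw [← hJ] at hp hcard
  -- Bases are equicardinal, so one base containing the double star gives the lower bound for all.
  obtain ⟨B', hB', hJB⟩ := hp.cayleyMengerMatroid_indep.exists_isBase_superset
  rw [h.ncard_eq_ncard_of_isBase hB']
  have := Set.ncard_le_ncard hJB
  rw [ncard_image_val, Nat.card_fin] at hcard
  omega

theorem image_edgesIn {n : ℕ} (G : SimpleGraph (Fin n)) :
    (Subtype.val '' edgesIn G : Set (Sym2 (Fin n))) = G.edgeSet := by
  rw [edgesIn, Set.image_preimage_eq_iff, Subtype.range_coe]
  exact SimpleGraph.edgeSet_mono le_top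

end Rigidity

/-! ### Laman's criterion, bases, and the equality of matroids -/

theorem mainTheorem7 (n : ℕ) (hn : 2 ≤ n) :
    (∀ G : SimpleGraph (Fin n),
      ((Rigidity.cayleyMengerMatroid 2 n).Indep (Rigidity.edgesIn G) ↔
        ∀ H : G.Subgraph, 2 ≤ H.verts.ncard →
          (H.edgeSet.ncard : ℤ) ≤ 2 * (H.verts.ncard : ℤ) - 3) ∧
      ((Rigidity.cayleyMengerMatroid 2 n).Indep (Rigidity.edgesIn G) →
        ((Rigidity.cayleyMengerMatroid 2 n).IsBase (Rigidity.edgesIn G) ↔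
          (G.edgeSet.ncard : ℤ) = 2 * (n : ℤ) - 3))) ∧
    Rigidity.cayleyMengerMatroid 2 n =
      Rigidity.twiceRankSubOneMatroid (Rigidity.graphicMatroid (SimpleGraph.completeGraph (Fin n))) := by
  refine ⟨fun G ↦ ⟨?_, fun hG ↦ ?_⟩, ?_⟩
  · rw [Rigidity.cayleyMengerMatroid_indep_iff_sparse, Rigidity.image_edgesIn,
      Rigidity.sparse_edgeSet_iff]
  · rw [← Rigidity.image_edgesIn G, Rigidity.ncard_image_val]
    refine ⟨Rigidity.ncard_of_isBase hn, fun hcard ↦ ?_⟩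
    obtain ⟨B, hB, hGB⟩ := hG.exists_isBase_superset
    have hBcard := Rigidity.ncard_of_isBase hn hB
    rwa [Set.eq_of_subset_of_ncard_le hGB (by omega)]
  · exact Matroid.ext_indep rfl fun I _ ↦
      Rigidity.cayleyMengerMatroid_indep_iff_submodularIndep
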